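/- **Proposition 2.11.** Consider unoriented 2-tangles in a 3-ball (with end points NW, SW, NE, SE), up to isotopy fixing the boundary. A *$\pm5$-move* replaces two parallel strands by five half-twists of one and the same sign, and two tangles are *5-move equivalent* if they are related by finitely many isotopies, $\pm 5$-moves and inverses of such moves. For coprime integers $p,q$ let $[\frac pq]=[\frac{-p}{-q}]$ be the rational tangle with fraction $\frac pq$ in Conway's notation: $[0]$ consists of two horizontal strands, $[\frac10]$ of two vertical ones, $[a+x]$ is obtained from $[x]$ by adding the row $[a]$ of $|a|$ horizontal half-twists (of sign that of $a\in\mathbb Z$) on the right, and $[\frac1x]$ is the mirror image of $[x]$ rotated by a quarter turn. Every rational tangle $[\frac pq]$ lies in exactly one of the 5-move equivalence classes of the twelve tangles $[\frac10],[0],[-1],[1],[-2],[2],[\frac25],[\frac52],[\frac32],[-\frac32],[\frac12],[-\frac12]$. Namely, $[\frac pq]$ lies in the class of * $[\frac10]$ if and only if $q\equiv0$ and $p\equiv\pm1 \pmod 5$; * $[\frac25]$ if and only if $q\equiv0$ and $p\equiv\pm2 \pmod 5$; * $[0]$ if and only if $q\equiv\pm1$ and $p\equiv0 \pmod 5$;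 * $[\frac52]$ if and only if $q\equiv\pm2$ and $p\equiv0 \pmod 5$; * $[-1]$ if and only if $q\equiv\pm1$ and $p\equiv-q \pmod 5$; * $[\frac32]$ if and only if $q\equiv\pm2$ and $p\equiv-q \pmod 5$; * $[1]$ if and only if $q\equiv\pm1$ and $p\equiv q \pmod 5$; * $[-\frac32]$ if and only if $q\equiv\pm2$ and $p\equiv q \pmod 5$; * $[-2]$ if and only if $q\equiv\pm1$ and $p\equiv-2q \pmod 5$; * $[\frac12]$ if and only if $q\equiv\pm2$ and $p\equiv-2q \pmod 5$; * $[2]$ if and only if $q\equiv\pm1$ and $p\equiv2q \pmod 5$; * $[-\frac12]$ if and only if $q\equiv\pm2$ and $p\equiv2q \pmod 5$. Moreover, two rational tangles $[\frac pq]$ and $[\frac{p'}{q'}]$ are 5-move equivalent if and only if either $q\equiv q'$ and $p\equiv p' \pmod 5$, or $q\equiv-q'$ and $p\equiv-p' \pmod 5$. -/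

import Mathlib

/-!
Unoriented tangles in a rectangle times an interval (a 3-ball), presented by generic planar diagrams.
A diagram is read from left to right. At every moment it is crossed by finitely many strands, numbered
`0, 1, 2, …` from top to bottom, and it is a finite sequence of elementary events: a strand turns back
(`⊂` or `⊃`) or two neighbouring strands cross. Two diagrams present isotopic tangles (the isotopy
fixing the boundary of the ball) if and only if they are related by level-preserving planar isotopy
together with the moves `IsotopyMove` below, which are the planar and Reidemeister moves for
diagrams that are generic with respect to the left-to-right direction.
-/

namespace FiveMoves

/-- The elementary events of a diagram read from left to right. -/
inductive Piece
  /-- `⊂`: two neighbouring strands, joined at their left ends, come into being. -/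
  | birth
  /-- `⊃`: two neighbouring strands are joined at their right ends and disappear. -/
  | death
  /-- A crossing of two neighbouring strands; the strand that descends (from upper left to lower
  right) is the overpass. -/
  | pos
  /-- A crossing of two neighbouring strands; the strand that descends (from upper left to lower
  right) is the underpass. -/
  | neg

namespace Piece

/-- Number of strands entering on the left. -/
def ins : Piece → ℕ
  | birth => 0
  | death => 2
  | pos => 2
  | neg => 2

/-- Number of strands leaving on the right. -/
def outs : Piece → ℕ
  | birth => 2
  | death => 0
  | pos => 2
  | neg => 2

/-- Interchange over- and underpass. -/
def mirror : Piece → Piece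
  | birth => birth
  | death => death
  | pos => neg
  | neg => pos

end Piece

/-- A sequence of events; `(e, i)` is the event `e` taking place below exactly `i` strands, so its
first strand has number `i`. -/
abbrev Word := List (Piece × ℕ)

/-- `Runs w m n`: the word `w` is a diagram with `m` end points on the left and `n` end points on the
right. -/
def Runs : Word → ℕ → ℕ → Prop
  | [], m, n => m = n
  | (e, i) :: w, m, n => i + e.ins ≤ m ∧ Runs w (m - e.ins + e.outs) n

/-- Tangle diagrams with `m` end points on the left and `n` end points on the right. -/
def Diagram (m n : ℕ) : Type := {w : Word // Runs w m n}

/-- Diagrams of 2-tangles: end points NW, SW (strands `0`, `1` on the left) and NE, SE (strands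
`0`, `1` on the right). -/
abbrev TwoTangle : Type := Diagram 2 2

/-! ### Isotopy and 5-moves -/

open Piece in
/-- The local moves that generate isotopy of tangles. -/
inductive IsotopyMove : Word → Word → Prop
  /-- Two events with disjoint sets of strands, the second one below the first one, may be
  interchanged. -/
  | far (e f : Piece) (i k : ℕ) :
      IsotopyMove [(e, i), (f, i + e.outs + k)] [(f, i + e.ins + k), (e, i)]
  /-- Straightening an `S`-shaped strand. -/
  | zigzag₁ (i : ℕ) : IsotopyMove [(birth, i), (death, i + 1)] []
  | zigzag₂ (i : ℕ) : IsotopyMove [(birth, i + 1), (death, i)] []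
  /-- A strand passes under, or over, a turning point. -/
  | slide₁ (i : ℕ) : IsotopyMove [(birth, i), (pos, i + 1)] [(birth, i + 1), (neg, i)]
  | slide₂ (i : ℕ) : IsotopyMove [(birth, i), (neg, i + 1)] [(birth, i + 1), (pos, i)]
  | slide₃ (i : ℕ) : IsotopyMove [(pos, i + 1), (death, i)] [(neg, i), (death, i + 1)]
  | slide₄ (i : ℕ) : IsotopyMove [(neg, i + 1), (death, i)] [(pos, i), (death, i + 1)]
  /-- First Reidemeister move. -/
  | kink₁ (i : ℕ) : IsotopyMove [(birth, i), (pos, i)] [(birth, i)]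
  | kink₂ (i : ℕ) : IsotopyMove [(birth, i), (neg, i)] [(birth, i)]
  | kink₃ (i : ℕ) : IsotopyMove [(pos, i), (death, i)] [(death, i)]
  | kink₄ (i : ℕ) : IsotopyMove [(neg, i), (death, i)] [(death, i)]
  /-- Second Reidemeister move. -/
  | cancel₁ (i : ℕ) : IsotopyMove [(pos, i), (neg, i)] []
  | cancel₂ (i : ℕ) : IsotopyMove [(neg, i), (pos, i)] []
  /-- Third Reidemeister move. -/
  | braid (i : ℕ) :
      IsotopyMove [(pos, i), (pos, i + 1), (pos, i)] [(pos, i + 1), (pos, i), (pos, i + 1)]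

/-- The `±5`-move: two parallel strands are replaced by five half-twists of one and the same sign. -/
inductive FiveMove : Word → Word → Prop
  | plus (i : ℕ) : FiveMove [] (List.replicate 5 (Piece.pos, i))
  | minus (i : ℕ) : FiveMove [] (List.replicate 5 (Piece.neg, i))

/-- A local move `R` applied somewhere inside a diagram. -/
def Step (R : Word → Word → Prop) {m n : ℕ} (D D' : Diagram m n) : Prop :=
  ∃ u a b v : Word, R a b ∧ D.1 = u ++ a ++ v ∧ D'.1 = u ++ b ++ v

/-- Isotopy of tangles relative to the boundary. -/
def Isotopic {m n : ℕ} : Diagram m n → Diagram m n → Prop :=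
  Relation.EqvGen (Step IsotopyMove)

/-- 5-move equivalence: related by a finite sequence of isotopies, `±5`-moves and their inverses. -/
def FiveMoveEquiv {m n : ℕ} : Diagram m n → Diagram m n → Prop :=
  Relation.EqvGen fun D D' => Step IsotopyMove D D' ∨ Step FiveMove D D'

/-! ### Rational tangles -/

theorem runs_append {w w' : Word} {m n k : ℕ} (h : Runs w m n) (h' : Runs w' n k) :
    Runs (w ++ w') m k := by
  induction w generalizing m with
  | nil => cases h; exact h'
  | cons a w ih => exact ⟨h.1, ih h.2⟩

/-- The mirror image in the plane of the diagram: all crossings are changed. -/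
def mirrorWord (w : Word) : Word := w.map fun x => (x.1.mirror, x.2)

/-- Put `s` strands above a diagram. -/
def shiftWord (s : ℕ) (w : Word) : Word := w.map fun x => (x.1, s + x.2)

theorem runs_mirror {w : Word} {m n : ℕ} (h : Runs w m n) : Runs (mirrorWord w) m n := by
  induction w generalizing m with
  | nil => exact h
  | cons a w ih =>
    obtain ⟨e, i⟩ := a
    have hi : e.mirror.ins = e.ins := by cases e <;> rfl
    have ho : e.mirror.outs = e.outs := by cases e <;> rfl
    have h1 : i + e.ins ≤ m := h.1
    have h2 : Runs (mirrorWord w) (m - e.ins + e.outs) n := ih h.2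
    rw [← hi] at h1
    rw [← hi, ← ho] at h2
    exact ⟨h1, h2⟩

theorem runs_shift {w : Word} {m n : ℕ} (s t : ℕ) (h : Runs w m n) :
    Runs (shiftWord s w) (s + m + t) (s + n + t) := by
  induction w generalizing m with
  | nil => cases h; rfl
  | cons a w ih =>
    obtain ⟨e, i⟩ := a
    have h1 : i + e.ins ≤ m := h.1
    refine ⟨by show s + i + e.ins ≤ s + m + t; omega, ?_⟩
    have h2 := ih h.2
    have h3 : s + (m - e.ins + e.outs) + t = s + m + t - e.ins + e.outs := by omega
    rw [h3] at h2
    exact h2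

/-- The tangle sum: `T'` is placed to the right of `T`. -/
def add (T T' : TwoTangle) : TwoTangle := ⟨T.1 ++ T'.1, runs_append T.2 T'.2⟩

theorem runs_replicate (e : Piece) (hi : e.ins = 2) (ho : e.outs = 2) (k : ℕ) :
    Runs (List.replicate k (e, 0)) 2 2 := by
  induction k with
  | zero => rfl
  | succ k ih =>
    refine ⟨by simp [hi], ?_⟩
    simpa [hi, ho] using ih

/-- The integer tangle `[a]`: `|a|` horizontal half-twists, of sign that of `a`. In particular `[0]`
consists of two horizontal strands. -/
def integerTangle (a : ℤ) : TwoTangle :=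
  ⟨List.replicate a.natAbs (if 0 ≤ a then Piece.pos else Piece.neg, 0), by
    split_ifs <;> exact runs_replicate _ rfl rfl _⟩

/-- The tangle `[∞] = [1/0]`, of the shape `⊃⊂`. -/
def infinityTangle : TwoTangle :=
  ⟨[(Piece.death, 0), (Piece.birth, 0)], by simp [Runs, Piece.ins, Piece.outs]⟩

/-- Inversion of tangles: rotate counterclockwise by a quarter turn (NW goes to SW, SW to SE, SE to NE
and NE to NW) and take the mirror image. It turns the rational tangle `[x]` into `[1/x]`. -/
def inversion (T : TwoTangle) : TwoTangle :=
  ⟨(Piece.birth, 2) :: (shiftWord 1 (mirrorWord T.1) ++ [(Piece.death, 0)]), by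
    refine ⟨by simp [Piece.ins], ?_⟩
    exact runs_append (runs_shift 1 1 (runs_mirror T.2)) (by simp [Runs, Piece.ins, Piece.outs])⟩

/-- The standard diagram of the rational tangle `[a₀ + 1/(a₁ + 1/(a₂ + ⋯))]`; the empty continued
fraction stands for `1/0`. -/
def conway : List ℤ → TwoTangle
  | [] => infinityTangle
  | a :: l => add (inversion (conway l)) (integerTangle a)

/-- Numerator and denominator of `a₀ + 1/(a₁ + 1/(a₂ + ⋯))`, the empty continued fraction being
`1/0`. -/
def fraction : List ℤ → ℤ × ℤ
  | [] => (1, 0)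
  | a :: l => (a * (fraction l).1 + (fraction l).2, (fraction l).1)

/-- `T` is (a diagram of) the rational tangle `[p/q]`, where `p` and `q` are coprime integers: `T` is
isotopic to the tangle of a continued fraction expansion of `p/q`. Coprimality is automatic, and
`p/q` and `(-p)/(-q)` are the same fraction. -/
def IsRational (p q : ℤ) (T : TwoTangle) : Prop :=
  ∃ l : List ℤ, (fraction l = (p, q) ∨ fraction l = (-p, -q)) ∧ Isotopic T (conway l)

/-- `T` lies in the 5-move equivalence class of the rational tangle `[r/s]`. -/
def InClass (r s : ℤ) (T : TwoTangle) : Prop :=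
  ∃ R : TwoTangle, IsRational r s R ∧ FiveMoveEquiv T R

/-- The fractions of the twelve tangles `[1/0]`, `[0]`, `[-1]`, `[1]`, `[-2]`, `[2]`, `[2/5]`,
`[5/2]`, `[3/2]`, `[-3/2]`, `[1/2]`, `[-1/2]`, as pairs of numerator and denominator. -/
def twelveFractions : Finset (ℤ × ℤ) :=
  {(1, 0), (0, 1), (-1, 1), (1, 1), (-2, 1), (2, 1), (2, 5), (5, 2), (3, 2), (-3, 2), (1, 2), (-1, 2)}

/-- Every fraction in lowest terms has a continued fraction expansion, so `[p/q]` exists. -/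
theorem exists_isRational (p q : ℤ) (h : IsCoprime p q) : ∃ T, IsRational p q T := by
  suffices H : ∀ (n : ℕ) (p q : ℤ), q.natAbs = n → IsCoprime p q →
      ∃ l, fraction l = (p, q) ∨ fraction l = (-p, -q) by
    obtain ⟨l, hl⟩ := H _ p q rfl h
    exact ⟨conway l, l, hl, Relation.EqvGen.refl _⟩
  intro n
  induction n using Nat.strong_induction_on with
  | _ n ih =>
    intro p q hn hc
    by_cases hq : q = 0
    · subst hq
      have hu : IsUnit p := isCoprime_zero_right.mp hc
      rcases Int.isUnit_iff.mp hu with rfl | rfl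
      · exact ⟨[], Or.inl rfl⟩
      · exact ⟨[], Or.inr rfl⟩
    · have hlt : (p % q).natAbs < n := by
        have h1 := Int.emod_nonneg p hq
        have h2 := Int.emod_lt_abs p hq
        rw [Int.abs_eq_natAbs] at h2
        omega
      have hc' : IsCoprime q (p % q) := by
        have h3 : p % q = p + q * (-(p / q)) := by
          have := Int.emod_add_mul_ediv p q
          linarith
        rw [h3]
        exact hc.symm.add_mul_left_right _
      have hp := Int.emod_add_mul_ediv p q
      obtain ⟨l, hl | hl⟩ := ih _ hlt q (p % q) rfl hc'
      · refine ⟨(p / q) :: l, Or.inl ?_⟩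
        simp only [fraction, hl, Prod.mk.injEq, and_true]
        linarith
      · refine ⟨(p / q) :: l, Or.inr ?_⟩
        simp only [fraction, hl, Prod.mk.injEq, and_true]
        linarith

end FiveMoves

open FiveMoves

/-! The residue of `(p, q)` modulo 5, up to a common sign, is a complete invariant of rational
tangles; it takes `(25 - 1) / 2 = 12` values.

Invariance. The Kauffman bracket at `A ^ 4 = -1` gives a closed loop the value 0. Rescale each
crossing to `1 ± j U`, where `U` is the operator of `⊃⊂` and `j ^ 2 = -1`; then isotopies change the
bracket by powers of `j` only. As `U ^ 2 = 0`, a row of `n` half-twists of one sign has the value `1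
± n j U`, so 5-moves are invisible where `5 = 0`. Up to a power of `j`, the tangle `[p/q]` has the
value `q + j p U` (`wordOp_shiftWord_conway`), and over `ZMod 5 × ZMod 5` with `j = (2, 3)` this
determines `(p, q)` up to sign. The operators act on functions of infinite two-valued sequences, the
labels of the strands, so that a single module serves diagrams with any number of strands.

Upper bound. Once the left ends are bent to the right, `twist 1` and `twist 2` satisfy the relation
of the braid group on three strands, and 5-moves give them order dividing five. All rational tangles
lie in the orbit of the bent `[1/0]` (`twistOrbit_bend_conway`), and this orbit has at most twelve
points (`exists_twelve_points`). The twelve listed tangles have different invariants, so they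
exhaust the orbit, and tangles with equal invariants are equivalent to the same one of them. -/

namespace FiveMoves

/-! ### A state sum with values in a ring with a square root of `-1` -/

section StateSum

/-- Insert two entries at position `i` of a sequence. -/
def insertTwo (i : ℕ) (a b : Bool) (s : ℕ → Bool) : ℕ → Bool := fun n =>
  if n < i then s n else if n = i then a else if n = i + 1 then b else s (n - 2)

/-- Remove the entries at positions `i` and `i + 1` of a sequence. -/
def removeTwo (i : ℕ) (s : ℕ → Bool) : ℕ → Bool := fun n => if n < i then s n else s (n + 2)

variable {R : Type*} [CommRing R] (j : R)

/-- The weight of a turning point `⊃`. -/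
def capWeight : Bool → Bool → R
  | false, true => 1
  | true, false => j
  | _, _ => 0

/-- The operator of the event `⊂` below `i` strands. -/
def birthOp (i : ℕ) : Module.End R ((ℕ → Bool) → R) where
  toFun f s := -j * f (insertTwo i false true s) + f (insertTwo i true false s)
  map_add' f g := by ext s; simp only [Pi.add_apply]; ring
  map_smul' c f := by ext s; simp only [Pi.smul_apply, smul_eq_mul, RingHom.id_apply]; ring

/-- The operator of the event `⊃` below `i` strands. -/
def deathOp (i : ℕ) : Module.End R ((ℕ → Bool) → R) where
  toFun f s := capWeight j (s i) (s (i + 1)) * f (removeTwo i s)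
  map_add' f g := by ext s; simp only [Pi.add_apply]; ring
  map_smul' c f := by ext s; simp only [Pi.smul_apply, smul_eq_mul, RingHom.id_apply]; ring

/-- The operator of an elementary event. -/
def pieceOp : Piece → ℕ → Module.End R ((ℕ → Bool) → R)
  | .birth, i => birthOp j i
  | .death, i => deathOp j i
  | .pos, i => 1 + j • (deathOp j i * birthOp j i)
  | .neg, i => 1 - j • (deathOp j i * birthOp j i)

/-- The operator of a diagram. -/
def wordOp (w : Word) : Module.End R ((ℕ → Bool) → R) := (w.map fun x => pieceOp j x.1 x.2).prod

theorem wordOp_append (w w' : Word) : wordOp j (w ++ w') = wordOp j w * wordOp j w' := by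
  simp [wordOp]

theorem wordOp_nil : wordOp j [] = 1 := rfl

theorem wordOp_cons (e : Piece) (i : ℕ) (w : Word) :
    wordOp j ((e, i) :: w) = pieceOp j e i * wordOp j w := by
  simp [wordOp]

/-! ### Commutation of distant events. -/

theorem insertTwo_insertTwo (i k : ℕ) (a b c d : Bool) (s : ℕ → Bool) :
    insertTwo (i + 2 + k) c d (insertTwo i a b s) = insertTwo i a b (insertTwo (i + k) c d s) := by
  funext n
  simp only [insertTwo]
  split_ifs <;> first | rfl | omega

theorem removeTwo_insertTwo (i k : ℕ) (a b : Bool) (s : ℕ → Bool) :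
    removeTwo (i + 2 + k) (insertTwo i a b s) = insertTwo i a b (removeTwo (i + k) s) := by
  funext n
  simp only [insertTwo, removeTwo]
  split_ifs <;> first | rfl | omega | (congr 1; omega)

theorem insertTwo_removeTwo (i k : ℕ) (a b : Bool) (s : ℕ → Bool) :
    insertTwo (i + k) a b (removeTwo i s) = removeTwo i (insertTwo (i + 2 + k) a b s) := by
  funext n
  simp only [insertTwo, removeTwo]
  split_ifs <;> first | rfl | omega | (congr 1; omega)

theorem removeTwo_removeTwo (i k : ℕ) (s : ℕ → Bool) :
    removeTwo (i + k) (removeTwo i s) = removeTwo i (removeTwo (i + 2 + k) s) := by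
  funext n
  simp only [removeTwo]
  split_ifs <;> first | rfl | omega

theorem sub_smul_eq_add (x y : Module.End R ((ℕ → Bool) → R)) (c : R) :
    x - c • y = x + (-c) • y := by
  ext f s
  simp only [LinearMap.sub_apply, LinearMap.add_apply, LinearMap.smul_apply, Pi.sub_apply,
    Pi.add_apply, Pi.smul_apply, smul_eq_mul]
  ring

theorem birthOp_mul_birthOp (i k : ℕ) :
    birthOp j i * birthOp j (i + 2 + k) = birthOp j (i + k) * birthOp j i := by
  ext f s
  simp only [Module.End.mul_apply, birthOp, LinearMap.coe_mk, AddHom.coe_mk, insertTwo_insertTwo]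
  ring

theorem birthOp_mul_deathOp (i k : ℕ) :
    birthOp j i * deathOp j (i + 2 + k) = deathOp j (i + k) * birthOp j i := by
  ext f s
  have h (a b : Bool) : insertTwo i a b s (i + 2 + k) = s (i + k) := by
    simp only [insertTwo]
    split_ifs <;> first | omega | (congr 1; omega)
  have h' (a b : Bool) : insertTwo i a b s (i + 2 + k + 1) = s (i + k + 1) := by
    simp only [insertTwo]
    split_ifs <;> first | omega | (congr 1; omega)
  simp only [Module.End.mul_apply, birthOp, deathOp, LinearMap.coe_mk, AddHom.coe_mk,
    removeTwo_insertTwo, h, h']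
  ring

theorem deathOp_mul_birthOp (i k : ℕ) :
    deathOp j i * birthOp j (i + k) = birthOp j (i + 2 + k) * deathOp j i := by
  ext f s
  have h (a b : Bool) : insertTwo (i + 2 + k) a b s i = s i := if_pos (by omega)
  have h' (a b : Bool) : insertTwo (i + 2 + k) a b s (i + 1) = s (i + 1) := if_pos (by omega)
  simp only [Module.End.mul_apply, birthOp, deathOp, LinearMap.coe_mk, AddHom.coe_mk,
    insertTwo_removeTwo, h, h']
  ring

theorem deathOp_mul_deathOp (i k : ℕ) :
    deathOp j i * deathOp j (i + k) = deathOp j (i + 2 + k) * deathOp j i := by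
  ext f s
  have h : removeTwo i s (i + k) = s (i + 2 + k) := by
    simp only [removeTwo]
    split_ifs <;> first | omega | (congr 1; omega)
  have h' : removeTwo i s (i + k + 1) = s (i + 2 + k + 1) := by
    simp only [removeTwo]
    split_ifs <;> first | omega | (congr 1; omega)
  have h1 : removeTwo (i + 2 + k) s i = s i := if_pos (by omega)
  have h2 : removeTwo (i + 2 + k) s (i + 1) = s (i + 1) := if_pos (by omega)
  simp only [Module.End.mul_apply, deathOp, LinearMap.coe_mk, AddHom.coe_mk,
    removeTwo_removeTwo, h, h', h1, h2]
  ring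

/-- A crossing is a combination of `1` and `deathOp * birthOp`, so the four commutations between
births and deaths imply all others. The crossings in place of `e` are settled inside `hb` and `hd`,
those in place of `f` at the end. -/
theorem pieceOp_far (e f : Piece) (i k : ℕ) :
    pieceOp j e i * pieceOp j f (i + e.outs + k) = pieceOp j f (i + e.ins + k) * pieceOp j e i := by
  have hb (e : Piece) : pieceOp j e i * birthOp j (i + e.outs + k) =
      birthOp j (i + e.ins + k) * pieceOp j e i := by
    have h := birthOp_mul_birthOp j i k
    have h' := deathOp_mul_birthOp j i k
    have h3 : deathOp j i * birthOp j i * birthOp j (i + 2 + k) =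
        birthOp j (i + 2 + k) * (deathOp j i * birthOp j i) := by
      rw [mul_assoc, h, ← mul_assoc, h', mul_assoc]
    cases e
    · exact h
    · exact h'
    · simp only [pieceOp, Piece.ins, Piece.outs, add_mul, mul_add, one_mul, mul_one,
        smul_mul_assoc, mul_smul_comm, h3]
    · simp only [pieceOp, Piece.ins, Piece.outs, sub_mul, mul_sub, one_mul, mul_one,
        smul_mul_assoc, mul_smul_comm, h3]
  have hd (e : Piece) : pieceOp j e i * deathOp j (i + e.outs + k) =
      deathOp j (i + e.ins + k) * pieceOp j e i := by
    have h := birthOp_mul_deathOp j i k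
    have h' := deathOp_mul_deathOp j i k
    have h3 : deathOp j i * birthOp j i * deathOp j (i + 2 + k) =
        deathOp j (i + 2 + k) * (deathOp j i * birthOp j i) := by
      rw [mul_assoc, h, ← mul_assoc, h', mul_assoc]
    cases e
    · exact h
    · exact h'
    · simp only [pieceOp, Piece.ins, Piece.outs, add_mul, mul_add, one_mul, mul_one,
        smul_mul_assoc, mul_smul_comm, h3]
    · simp only [pieceOp, Piece.ins, Piece.outs, sub_mul, mul_sub, one_mul, mul_one,
        smul_mul_assoc, mul_smul_comm, h3]
  have h3 : pieceOp j e i * (deathOp j (i + e.outs + k) * birthOp j (i + e.outs + k)) =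
      deathOp j (i + e.ins + k) * birthOp j (i + e.ins + k) * pieceOp j e i := by
    rw [← mul_assoc, hd, mul_assoc, hb, mul_assoc]
  cases f
  · exact hb e
  · exact hd e
  · rw [pieceOp, pieceOp, mul_add, add_mul, mul_smul_comm, smul_mul_assoc, h3, mul_one, one_mul]
  · rw [pieceOp, pieceOp, mul_sub, sub_mul, mul_smul_comm, smul_mul_assoc, h3, mul_one, one_mul]

/-! ### Temperley–Lieb relations with loop value 0, and invariance under the moves. -/

theorem birthOp_mul_deathOp_self (i : ℕ) : birthOp j i * deathOp j i = 0 := by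
  ext f s
  have h (a b : Bool) : insertTwo i a b s i = a := by simp [insertTwo]
  have h' (a b : Bool) : insertTwo i a b s (i + 1) = b := by simp [insertTwo]
  have h3 (a b : Bool) : removeTwo i (insertTwo i a b s) = s := by
    funext n
    simp only [insertTwo, removeTwo]
    split_ifs <;> first | rfl | omega
  -- The two states of the circle contribute `-j * 1` and `1 * j`.
  simp only [Module.End.mul_apply, birthOp, deathOp, LinearMap.coe_mk, AddHom.coe_mk,
    LinearMap.zero_apply, Pi.zero_apply, h, h', h3, capWeight]
  ring

/-- The matrices of `⊂` and `⊃` are inverse to each other: for either label of the strand exactly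
one state survives, with weight `-j * j = 1` or `1 * 1`. -/
theorem birthOp_mul_deathOp_succ (i : ℕ) (hj : j * j = -1) :
    birthOp j i * deathOp j (i + 1) = 1 := by
  ext f s
  have h (a b : Bool) : insertTwo i a b s (i + 1) = b := by simp [insertTwo]
  have h' (a b : Bool) : insertTwo i a b s (i + 1 + 1) = s i := by
    simp [insertTwo, show ¬ i + 1 + 1 < i by omega, show i + 1 + 1 ≠ i by omega]
  have h3 (b : Bool) : removeTwo (i + 1) (insertTwo i (s i) b s) = s := by
    funext n
    simp only [insertTwo, removeTwo]
    split_ifs <;> first | rfl | omega | (congr 1; omega)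
  simp only [Module.End.mul_apply, birthOp, deathOp, LinearMap.coe_mk, AddHom.coe_mk,
    Module.End.one_apply, h, h']
  cases hs : s i
  · have h4 := h3 true
    rw [hs] at h4
    simp only [h4, capWeight]
    linear_combination (-f s) * hj
  · have h4 := h3 false
    rw [hs] at h4
    simp only [h4, capWeight]
    ring

theorem birthOp_succ_mul_deathOp (i : ℕ) (hj : j * j = -1) :
    birthOp j (i + 1) * deathOp j i = 1 := by
  ext f s
  have h (a b : Bool) : insertTwo (i + 1) a b s i = s i := by simp [insertTwo]
  have h' (a b : Bool) : insertTwo (i + 1) a b s (i + 1) = a := by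
    simp [insertTwo]
  have h3 (b : Bool) : removeTwo i (insertTwo (i + 1) b (s i) s) = s := by
    funext n
    simp only [insertTwo, removeTwo]
    split_ifs <;> first | rfl | omega | (congr 1; omega)
  simp only [Module.End.mul_apply, birthOp, deathOp, LinearMap.coe_mk, AddHom.coe_mk,
    Module.End.one_apply, h, h']
  cases hs : s i
  · have h4 := h3 true
    rw [hs] at h4
    simp only [h4, capWeight]
    ring
  · have h4 := h3 false
    rw [hs] at h4
    simp only [h4, capWeight]
    linear_combination (-f s) * hj

/-- The term `j ^ 3 * x y x = -j x` cancels one of the two copies of `j x`. What remains is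
symmetric in `x` and `y`, which yields the third Reidemeister move. -/
theorem braid_relation {A : Type*} [Ring A] [Algebra R A] {j : R} (hj : j * j = -1) {x y : A}
    (hx : x * x = 0) (hxy : x * y * x = x) :
    (1 + j • x) * (1 + j • y) * (1 + j • x) =
      1 + j • x + j • y - x * y - y * x := by
  simp only [add_mul, mul_add, one_mul, mul_one, smul_mul_assoc, mul_smul_comm, hx, hxy,
    smul_add, smul_smul, hj, smul_zero, neg_smul, one_smul, neg_mul, smul_neg, add_zero]
  module

/-- An isotopy move changes the operator of a diagram by a power of `j`. -/
theorem IsotopyMove.wordOp_eq (hj : j * j = -1) {a b : Word} (h : IsotopyMove a b) :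
    ∃ k : ℕ, wordOp j a = j ^ k • wordOp j b := by
  have hs (i : ℕ) := birthOp_mul_deathOp_self j i
  have h1 (i : ℕ) := birthOp_mul_deathOp_succ j i hj
  have h2 (i : ℕ) := birthOp_succ_mul_deathOp j i hj
  have h1' (i : ℕ) (z : Module.End R ((ℕ → Bool) → R)) :
      birthOp j i * (deathOp j (i + 1) * z) = z := by rw [← mul_assoc, h1, one_mul]
  have h2' (i : ℕ) (z : Module.End R ((ℕ → Bool) → R)) :
      birthOp j (i + 1) * (deathOp j i * z) = z := by rw [← mul_assoc, h2, one_mul]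
  have hs' (i : ℕ) (z : Module.End R ((ℕ → Bool) → R)) :
      birthOp j i * (deathOp j i * z) = 0 := by rw [← mul_assoc, hs, zero_mul]
  have hj3 : j ^ 3 = -j := by linear_combination j * hj
  have hj3' : -j * j = 1 := by linear_combination -hj
  have hw (e f : Piece) (i k : ℕ) : wordOp j [(e, i), (f, k)] = pieceOp j e i * pieceOp j f k := by
    simp [wordOp]
  have hw1 (e : Piece) (i : ℕ) : wordOp j [(e, i)] = pieceOp j e i := by simp [wordOp]
  cases h with
  | far e f i k => exact ⟨0, by rw [hw, hw, pow_zero, one_smul, pieceOp_far]⟩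
  | zigzag₁ i => exact ⟨0, by rw [hw, pow_zero, one_smul]; exact h1 i⟩
  | zigzag₂ i => exact ⟨0, by rw [hw, pow_zero, one_smul]; exact h2 i⟩
  | slide₁ i =>
    -- With `b = birthOp j i` and `b' = birthOp j (i + 1)` the two sides are `b + j b'` and `b' - j
    -- b`, whose ratio is `j`. For crossings of the other sign it is `-j = j ^ 3`.
    refine ⟨1, ?_⟩
    simp only [hw, pieceOp, mul_add, mul_sub, mul_one, mul_smul_comm, h1', h2', pow_one,
      smul_sub, smul_smul, hj, neg_smul, one_smul]
    module
  | slide₂ i =>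
    refine ⟨3, ?_⟩
    simp only [hw, pieceOp, mul_add, mul_sub, mul_one, mul_smul_comm, h1', h2', hj3,
      smul_add, smul_smul, hj3', neg_smul, one_smul]
    module
  | slide₃ i =>
    refine ⟨1, ?_⟩
    simp only [hw, pieceOp, add_mul, sub_mul, one_mul, smul_mul_assoc, mul_assoc, h1, h2, mul_one,
      pow_one, smul_sub, smul_smul, hj, neg_smul, one_smul]
    module
  | slide₄ i =>
    refine ⟨3, ?_⟩
    simp only [hw, pieceOp, add_mul, sub_mul, one_mul, smul_mul_assoc, mul_assoc, h1, h2, mul_one,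
      hj3, smul_add, smul_smul, hj3', neg_smul, one_smul]
    module
  | kink₁ i => exact ⟨0, by simp [hw, hw1, pieceOp, mul_add, hs']⟩
  | kink₂ i => exact ⟨0, by simp [hw, hw1, pieceOp, mul_sub, hs']⟩
  | kink₃ i => exact ⟨0, by simp [hw, hw1, pieceOp, add_mul, mul_assoc, hs]⟩
  | kink₄ i => exact ⟨0, by simp [hw, hw1, pieceOp, sub_mul, mul_assoc, hs]⟩
  | cancel₁ i =>
    exact ⟨0, by simp [hw, pieceOp, add_mul, mul_sub, mul_assoc, hs', wordOp_nil]⟩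
  | cancel₂ i =>
    exact ⟨0, by simp [hw, pieceOp, sub_mul, mul_add, mul_assoc, hs', wordOp_nil]⟩
  | braid i =>
    refine ⟨0, ?_⟩
    simp only [wordOp, List.map_cons, List.map_nil, List.prod_cons, List.prod_nil, mul_one,
      pow_zero, one_smul, pieceOp]
    rw [← mul_assoc, ← mul_assoc, braid_relation hj, braid_relation hj]
    · abel
    all_goals simp only [mul_assoc, hs', h1', h2', mul_zero]

/-- A 5-move does not change the operator of a diagram when `5 = 0`. -/
theorem FiveMove.wordOp_eq (h5 : (5 : R) = 0) {a b : Word} (h : FiveMove a b) :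
    wordOp j a = wordOp j b := by
  have hx (i : ℕ) : (deathOp j i * birthOp j i) * (deathOp j i * birthOp j i) = 0 := by
    rw [mul_assoc, ← mul_assoc (birthOp j i), birthOp_mul_deathOp_self j i, zero_mul, mul_zero]
  have key (c : R) (x : Module.End R ((ℕ → Bool) → R)) (hx : x * x = 0) (n : ℕ) :
      (1 + c • x) ^ n = 1 + ((n : R) * c) • x := by
    induction n with
    | zero => simp
    | succ n ih =>
      rw [pow_succ, ih]
      simp only [add_mul, mul_add, one_mul, mul_one, smul_mul_assoc, mul_smul_comm, hx, smul_zero,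
        Nat.cast_succ, add_smul]
      module
  cases h with
  | plus i =>
    rw [wordOp, wordOp, List.map_replicate, List.prod_replicate]
    show _ = (1 + j • (deathOp j i * birthOp j i)) ^ 5
    rw [key _ _ (hx i)]
    simp [h5]
  | minus i =>
    rw [wordOp, wordOp, List.map_replicate, List.prod_replicate]
    show _ = (1 - j • (deathOp j i * birthOp j i)) ^ 5
    rw [sub_smul_eq_add, key _ _ (hx i)]
    simp [h5]

theorem FiveMoveEquiv.wordOp_eq (hj : j * j = -1) (h5 : (5 : R) = 0) {m n : ℕ} {D D' : Diagram m n}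
    (h : FiveMoveEquiv D D') : ∃ k : ℕ, wordOp j D.1 = j ^ k • wordOp j D'.1 := by
  induction h with
  | rel D D' h =>
    rcases h with ⟨u, a, b, v, hab, h1, h2⟩ | ⟨u, a, b, v, hab, h1, h2⟩
    · obtain ⟨k, hk⟩ := IsotopyMove.wordOp_eq j hj hab
      exact ⟨k, by simp [h1, h2, wordOp_append, hk]⟩
    · exact ⟨0, by simp [h1, h2, wordOp_append, FiveMove.wordOp_eq j h5 hab]⟩
  | refl D => exact ⟨0, by simp⟩
  | symm D D' _ ih =>
    obtain ⟨k, hk⟩ := ih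
    -- As `j ^ 4 = 1`, the inverse of `j ^ k` is `j ^ (3 * k)`.
    refine ⟨3 * k, ?_⟩
    have : j ^ (3 * k) * j ^ k = 1 := by
      rw [← pow_add, show 3 * k + k = 4 * k by ring, pow_mul,
        show j ^ 4 = 1 by linear_combination (j * j - 1) * hj, one_pow]
    rw [hk, smul_smul, this, one_smul]
  | trans D D' D'' _ _ ih ih' =>
    obtain ⟨k, hk⟩ := ih
    obtain ⟨l, hl⟩ := ih'
    exact ⟨k + l, by rw [hk, hl, smul_smul, pow_add]⟩

theorem isotopic_imp_fiveMoveEquiv {m n : ℕ} {D D' : Diagram m n} (h : Isotopic D D') :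
    FiveMoveEquiv D D' :=
  Relation.EqvGen.mono (fun _ _ h => Or.inl h) _ _ h

/-- Up to a power of `j`, the operator of the tangle `[p/q]` below `s` strands is `q + j p U`, where
`U` is the operator of `⊃⊂`; that of its mirror image is `q - j p U`. -/
theorem wordOp_shiftWord_conway (hj : j * j = -1) (l : List ℤ) (s : ℕ) :
    (∃ k : ℕ, wordOp j (shiftWord s (conway l).1) =
      j ^ k • (((fraction l).2 : R) • 1 + (j * ((fraction l).1 : R)) • (deathOp j s * birthOp j s))) ∧
    (∃ k : ℕ, wordOp j (shiftWord s (mirrorWord (conway l).1)) =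
      j ^ k • (((fraction l).2 : R) • 1 -
        (j * ((fraction l).1 : R)) • (deathOp j s * birthOp j s))) := by
  have hj3 : j ^ 3 = -j := by linear_combination j * hj
  have hx (i : ℕ) : (deathOp j i * birthOp j i) * (deathOp j i * birthOp j i) = 0 := by
    rw [mul_assoc, ← mul_assoc (birthOp j i), birthOp_mul_deathOp_self j i, zero_mul, mul_zero]
  have hpow (c : R) (n i : ℕ) :
      (1 + c • (deathOp j i * birthOp j i)) ^ n = 1 + (n * c) • (deathOp j i * birthOp j i) := by
    induction n with
    | zero => simp
    | succ n ih =>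
      rw [pow_succ, ih]
      simp only [add_mul, mul_add, one_mul, mul_one, smul_mul_assoc, mul_smul_comm, hx, smul_zero,
        Nat.cast_succ, add_smul]
      module
  have hint (a : ℤ) (s : ℕ) : wordOp j (shiftWord s (integerTangle a).1) =
      1 + (j * (a : R)) • (deathOp j s * birthOp j s) := by
    simp only [integerTangle, shiftWord, wordOp, List.map_replicate, List.prod_replicate, add_zero]
    split_ifs with ha
    · rw [pieceOp, hpow]
      conv_rhs => rw [← Int.natAbs_of_nonneg ha]
      rw [Int.cast_natCast, mul_comm]
    · rw [pieceOp, sub_smul_eq_add, hpow]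
      have : (a : R) = -((a.natAbs : ℕ) : R) := by
        rw [← Int.cast_natCast, Int.natCast_natAbs, abs_of_neg (by omega)]
        push_cast
        ring
      rw [this]
      congr 2
      ring
  have hint' (a : ℤ) (s : ℕ) : wordOp j (shiftWord s (mirrorWord (integerTangle a).1)) =
      1 - (j * (a : R)) • (deathOp j s * birthOp j s) := by
    simp only [integerTangle, shiftWord, mirrorWord, wordOp, List.map_replicate,
      List.prod_replicate, add_zero]
    split_ifs with ha
    · rw [Piece.mirror, pieceOp, sub_smul_eq_add,
        hpow, sub_smul_eq_add]
      conv_rhs => rw [← Int.natAbs_of_nonneg ha]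
      rw [Int.cast_natCast]
      congr 2
      ring
    · rw [Piece.mirror, pieceOp, hpow, sub_smul_eq_add]
      have : (a : R) = -((a.natAbs : ℕ) : R) := by
        rw [← Int.cast_natCast, Int.natCast_natAbs, abs_of_neg (by omega)]
        push_cast
        ring
      rw [this]
      congr 2
      ring
  -- A quarter turn interchanges the two crossingless tangles `1` and `U`, hence their coefficients.
  have hturn (c d : R) (s : ℕ) : birthOp j (s + 2) *
      ((c • 1 + d • (deathOp j (s + 1) * birthOp j (s + 1))) * deathOp j s) =
      d • 1 + c • (deathOp j s * birthOp j s) := by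
    rw [add_mul, mul_add, smul_mul_assoc, smul_mul_assoc, one_mul, mul_assoc,
      birthOp_succ_mul_deathOp j s hj, mul_one, mul_smul_comm, mul_smul_comm,
      birthOp_succ_mul_deathOp j (s + 1) hj, ← deathOp_mul_birthOp j s 0, add_comm]
    rfl
  have happ (s : ℕ) (w w' : Word) : wordOp j (shiftWord s (w ++ w')) =
      wordOp j (shiftWord s w) * wordOp j (shiftWord s w') := by
    rw [shiftWord, List.map_append, wordOp_append]
    rfl
  have happ' (s : ℕ) (w w' : Word) : wordOp j (shiftWord s (mirrorWord (w ++ w'))) =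
      wordOp j (shiftWord s (mirrorWord w)) * wordOp j (shiftWord s (mirrorWord w')) := by
    rw [mirrorWord, List.map_append, happ]
    rfl
  -- Inversion puts the mirror image below one more strand: hence the simultaneous induction on both
  -- images, for every `s`.
  induction l generalizing s with
  | nil =>
    constructor
    · refine ⟨3, ?_⟩
      simp [conway, infinityTangle, shiftWord, wordOp, pieceOp, fraction, hj3, smul_smul, hj]
    · refine ⟨1, ?_⟩
      simp [conway, infinityTangle, shiftWord, mirrorWord, Piece.mirror, wordOp, pieceOp, fraction,
        smul_smul, hj]
  | cons a l ih =>
    obtain ⟨⟨k, hk⟩, ⟨k', hk'⟩⟩ := ih (s + 1)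
    have hmm (w : Word) : mirrorWord (mirrorWord w) = w := by
      have : ∀ x : Piece × ℕ, (x.1.mirror.mirror, x.2) = x := by
        rintro ⟨_ | _ | _ | _, i⟩ <;> rfl
      simp only [mirrorWord, List.map_map]
      exact (List.map_congr_left fun x _ => this x).trans (List.map_id w)
    have hss (w : Word) : shiftWord s (shiftWord 1 w) = shiftWord (s + 1) w := by
      simp [shiftWord, Function.comp_def, add_assoc]
    have hms (t : ℕ) (w : Word) : mirrorWord (shiftWord t w) = shiftWord t (mirrorWord w) := by
      simp [shiftWord, mirrorWord, Function.comp_def]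
    constructor
    · refine ⟨k' + 3, ?_⟩
      have hinv : wordOp j (shiftWord s (inversion (conway l)).1) = j ^ (k' + 3) •
          (((fraction l).1 : R) • 1 + (j * ((fraction l).2 : R)) • (deathOp j s * birthOp j s)) := by
        show wordOp j ((.birth, s + 2) :: shiftWord s (_ ++ [(.death, 0)])) = _
        rw [wordOp_cons, happ, hss, hk', sub_smul_eq_add, smul_mul_assoc, mul_smul_comm]
        have : wordOp j (shiftWord s [(.death, 0)]) = deathOp j s := by
          simp [shiftWord, wordOp, pieceOp]
        rw [this, pieceOp, hturn, pow_add, hj3]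
        match_scalars
        · ring
        · linear_combination (j ^ k' * ((fraction l).2 : R)) * hj
      rw [conway, add, happ, hinv, hint, smul_mul_assoc]
      simp only [add_mul, mul_add, one_mul, mul_one, smul_mul_assoc, mul_smul_comm, hx, smul_zero,
        fraction, smul_smul, add_zero, add_assoc, ← add_smul]
      push_cast
      congr 4
      ring
    · refine ⟨k + 1, ?_⟩
      have hinv : wordOp j (shiftWord s (mirrorWord (inversion (conway l)).1)) = j ^ (k + 1) •
          (((fraction l).1 : R) • 1 +
            (-(j * ((fraction l).2 : R))) • (deathOp j s * birthOp j s)) := by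
        show wordOp j ((.birth, s + 2) :: shiftWord s (mirrorWord (_ ++ [(.death, 0)]))) = _
        rw [wordOp_cons, happ', hms, hmm, hss, hk, smul_mul_assoc, mul_smul_comm]
        have : wordOp j (shiftWord s (mirrorWord [(.death, 0)])) = deathOp j s := by
          simp [shiftWord, mirrorWord, Piece.mirror, wordOp, pieceOp]
        rw [this, pieceOp, hturn, pow_succ]
        match_scalars
        · ring
        · linear_combination (j ^ k * ((fraction l).2 : R)) * hj
      rw [conway, add, happ', hinv, hint', smul_mul_assoc, sub_smul_eq_add, sub_smul_eq_add]
      simp only [add_mul, mul_add, one_mul, mul_one, smul_mul_assoc, mul_smul_comm, hx, smul_zero,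
        fraction, smul_smul, add_zero, add_assoc, ← add_smul]
      push_cast
      congr 4
      ring

/-! ### The fraction modulo 5 and up to sign is an invariant. -/

theorem coeff_eq_of_eq (hj : j * j = -1) {a b c d : R}
    (h : a • 1 + b • (deathOp j 0 * birthOp j 0) = c • 1 + d • (deathOp j 0 * birthOp j 0)) :
    a = c ∧ b = d := by
  -- `U` vanishes on states whose first two labels agree, which isolates the coefficient of `1`.
  have h0 := congrFun (LinearMap.congr_fun h fun _ => 1) fun _ => false
  -- The test function vanishes at the state `true, false, false, …`, while `U` takes it there to `j
  -- * (-j) = 1`: this isolates the coefficient of `U`.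
  have h1 := congrFun (LinearMap.congr_fun h fun s => if s 0 = false then 1 else 0)
    fun n => decide (n = 0)
  simp [deathOp, birthOp, capWeight] at h0
  simp [deathOp, birthOp, capWeight, insertTwo] at h1
  refine ⟨h0, ?_⟩
  simp only [hj] at h1
  simpa using h1

theorem isCoprime_fraction (l : List ℤ) : IsCoprime (fraction l).1 (fraction l).2 := by
  induction l with
  | nil => exact isCoprime_one_left
  | cons a l ih =>
    show IsCoprime (a * (fraction l).1 + (fraction l).2) (fraction l).1
    rw [add_comm]
    exact ih.symm.add_mul_right_left a

theorem IsRational.isCoprime {p q : ℤ} {T : TwoTangle} (h : IsRational p q T) : IsCoprime p q := by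
  obtain ⟨l, hl, -⟩ := h
  have := isCoprime_fraction l
  rcases hl with hl | hl <;> rw [hl] at this
  · exact this
  · exact (IsCoprime.neg_neg_iff _ _).mp this

/-- Equality of two pairs of integers modulo 5 and up to a common sign. -/
def ModEqUpToSign (p q p' q' : ℤ) : Prop :=
  (q ≡ q' [ZMOD 5] ∧ p ≡ p' [ZMOD 5]) ∨ (q ≡ -q' [ZMOD 5] ∧ p ≡ -p' [ZMOD 5])

theorem modEqUpToSign_iff {p q p' q' : ℤ} : ModEqUpToSign p q p' q' ↔
    ((q : ZMod 5) = q' ∧ (p : ZMod 5) = p') ∨ ((q : ZMod 5) = -q' ∧ (p : ZMod 5) = -p') := by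
  have h (a b : ℤ) : a ≡ b [ZMOD 5] ↔ (a : ZMod 5) = b :=
    (ZMod.intCast_eq_intCast_iff a b 5).symm
  simp [ModEqUpToSign, h]

/-- In `ZMod 5` alone the powers of `j = 2` are all the units, and only the ratio of `p` and `q`
would survive. In `ZMod 5 × ZMod 5` integers are diagonal, and the only diagonal powers of `(2, 3)`
are `±1`; as `p` and `q` are not both zero modulo 5, the unknown factor is a sign. -/
theorem modEqUpToSign_of_fiveMoveEquiv_conway {l l' : List ℤ}
    (h : FiveMoveEquiv (conway l) (conway l')) :
    ModEqUpToSign (fraction l).1 (fraction l).2 (fraction l').1 (fraction l').2 := by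
  have hj : ((2, 3) : ZMod 5 × ZMod 5) * (2, 3) = -1 := by decide
  obtain ⟨k, hk⟩ := h.wordOp_eq ((2, 3) : ZMod 5 × ZMod 5) hj (by decide)
  have hz (w : Word) : shiftWord 0 w = w := by simp [shiftWord]
  obtain ⟨m, hm⟩ := (wordOp_shiftWord_conway _ hj l 0).1
  obtain ⟨m', hm'⟩ := (wordOp_shiftWord_conway _ hj l' 0).1
  rw [hz] at hm hm'
  rw [hm, hm', smul_add, smul_add, smul_add, smul_smul, smul_smul, smul_smul, smul_smul, smul_smul,
    smul_smul] at hk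
  obtain ⟨h1, h2⟩ := coeff_eq_of_eq _ hj hk
  have hc : ¬ (((fraction l).1 : ZMod 5) = 0 ∧ ((fraction l).2 : ZMod 5) = 0) := by
    rintro ⟨ha, hb⟩
    obtain ⟨x, y, hxy⟩ := isCoprime_fraction l
    have := congrArg (Int.cast : ℤ → ZMod 5) hxy
    push_cast at this
    rw [ha, hb, mul_zero, mul_zero, zero_add] at this
    exact absurd this (by decide)
  rw [modEqUpToSign_iff]
  have hpow (k : ℕ) : ((2, 3) : ZMod 5 × ZMod 5) ^ k ∈
      ({(1, 1), (2, 3), (4, 4), (3, 2)} : Finset (ZMod 5 × ZMod 5)) := by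
    induction k with
    | zero => decide
    | succ k ih =>
      rw [pow_succ]
      generalize ((2, 3) : ZMod 5 × ZMod 5) ^ k = z at ih
      revert z
      decide
  have hcast (a : ℤ) : (a : ZMod 5 × ZMod 5) = ((a : ZMod 5), (a : ZMod 5)) := by
    ext <;> simp
  rw [hcast, hcast] at h1 h2
  have hu := hpow m
  have hu' : ((2, 3) : ZMod 5 × ZMod 5) ^ k * (2, 3) ^ m' ∈
      ({(1, 1), (2, 3), (4, 4), (3, 2)} : Finset (ZMod 5 × ZMod 5)) := by
    rw [← pow_add]
    exact hpow (k + m')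
  generalize ((2, 3) : ZMod 5 × ZMod 5) ^ k * (2, 3) ^ m' = u' at *
  generalize ((2, 3) : ZMod 5 × ZMod 5) ^ m = u at *
  generalize ((fraction l).1 : ZMod 5) = p at *
  generalize ((fraction l).2 : ZMod 5) = q at *
  generalize ((fraction l').1 : ZMod 5) = p' at *
  generalize ((fraction l').2 : ZMod 5) = q' at *
  clear hk hm hm' h
  simp only [Finset.mem_insert, Finset.mem_singleton] at hu hu'
  have key : ∀ u ∈ ({(1, 1), (2, 3), (4, 4), (3, 2)} : Finset (ZMod 5 × ZMod 5)),
      ∀ u' ∈ ({(1, 1), (2, 3), (4, 4), (3, 2)} : Finset (ZMod 5 × ZMod 5)),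
      ∀ q q' p p' : ZMod 5, u * (q, q) = u' * (q', q') →
        u * ((2, 3) * (p, p)) = u' * ((2, 3) * (p', p')) → ¬ (p = 0 ∧ q = 0) →
        (q = q' ∧ p = p') ∨ (q = -q' ∧ p = -p') := by
    decide
  exact key u (by simpa using hu) u' (by simpa using hu') q q' p p' h1 h2 hc

end StateSum

/-! ### Twelve points permuted by two twists -/

/-- An orbit of the braid group on three strands whose generators have order five, with a base point
fixed by one generator and by one further relation, has at most twelve points. -/
theorem exists_twelve_points {X : Type*} {s t : X → X} {e : X} (hs : ∀ x, s (s (s (s (s x)))) = x)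
    (ht : ∀ x, t (t (t (t (t x)))) = x) (hst : ∀ x, s (t (s x)) = t (s (t x))) (he : t e = e)
    (he' : s (t (t (s e))) = e) :
    ∃ g : Fin 12 → X, (∃ k, g k = e) ∧ ∀ k, (∃ k', g k' = s (g k)) ∧ ∃ k', g k' = t (g k) := by
  have si {x y : X} (h : s x = s y) : x = y := by rw [← hs x, h, hs]
  have ti {x y : X} (h : t x = t y) : x = y := by rw [← ht x, h, ht]
  -- The points are modelled on the vertices of an icosahedron which `t` rotates: `e` and `f` are
  -- the poles, the `a`'s and the `b`'s the two rings. They need not be distinct.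
  obtain ⟨a₀, ha₀⟩ : ∃ a, a = s e := ⟨_, rfl⟩
  obtain ⟨b₀, hb₀⟩ : ∃ b, b = s a₀ := ⟨_, rfl⟩
  obtain ⟨a₁, ha₁⟩ : ∃ a, a = t a₀ := ⟨_, rfl⟩
  obtain ⟨a₂, ha₂⟩ : ∃ a, a = t a₁ := ⟨_, rfl⟩
  obtain ⟨a₃, ha₃⟩ : ∃ a, a = t a₂ := ⟨_, rfl⟩
  obtain ⟨a₄, ha₄⟩ : ∃ a, a = t a₃ := ⟨_, rfl⟩
  obtain ⟨b₁, hb₁⟩ : ∃ b, b = t b₀ := ⟨_, rfl⟩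
  obtain ⟨b₂, hb₂⟩ : ∃ b, b = t b₁ := ⟨_, rfl⟩
  obtain ⟨b₃, hb₃⟩ : ∃ b, b = t b₂ := ⟨_, rfl⟩
  obtain ⟨b₄, hb₄⟩ : ∃ b, b = t b₃ := ⟨_, rfl⟩
  obtain ⟨f, hf⟩ : ∃ f, f = s b₄ := ⟨_, rfl⟩
  -- It will turn out that `s` has the cycles `e a₀ b₀ b₁ a₂` and `a₃ a₄ b₄ f b₂` and fixes `a₁` and
  -- `b₃`. Each arrow comes from the braid relation at a point already understood, or from closing a
  -- cycle of length five.
  have ta₄ : a₀ = t a₄ := by rw [ha₄, ha₃, ha₂, ha₁, ht]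
  have tb₄ : b₀ = t b₄ := by rw [hb₄, hb₃, hb₂, hb₁, ht]
  have sa₁ : a₁ = s a₁ := by rw [ha₁, ha₀, hst, he]
  have sa₂ : e = s a₂ := by rw [ha₂, ha₁, ha₀, he']
  have sb₁ : a₂ = s b₁ := by rw [hb₁, hb₀, hst, ← ha₁, ← sa₁, ha₂]
  have sb₀ : b₁ = s b₀ := by
    apply si
    apply si
    rw [← sb₁, ← sa₂, hb₀, ha₀, hs]
  have sa₄ : b₄ = s a₄ := by
    apply ti
    apply si
    rw [hst, ← ta₄, ← hb₀, ← hb₁, ← tb₄, sb₀]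
  have sa₃ : a₄ = s a₃ := by
    apply ti
    rw [ha₃, ← hst, ← sa₂, he, ← ha₀, ← ta₄]
  have sb₂ : a₃ = s b₂ := by
    apply ti
    rw [hb₂, ← hst, ← sb₁, ← ha₃, ← ha₄, sa₃]
  have sf : b₂ = s f := by
    apply si
    rw [← sb₂, hf, sa₄, sa₃, hs]
  have sb₃ : b₃ = s b₃ := by
    apply ti
    rw [hb₃, ← hst, ← sb₂, ← ha₄, ← sa₄, ← hb₃, ← hb₄]
  have tf : f = t f := by rw [hf, hb₄, ← hst, ← sb₃]
  refine ⟨![e, a₀, a₁, a₂, a₃, a₄, b₀, b₁, b₂, b₃, b₄, f], ⟨0, rfl⟩, fun k => ?_⟩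
  fin_cases k
  · exact ⟨⟨1, ha₀⟩, ⟨0, he.symm⟩⟩
  · exact ⟨⟨6, hb₀⟩, ⟨2, ha₁⟩⟩
  · exact ⟨⟨2, sa₁⟩, ⟨3, ha₂⟩⟩
  · exact ⟨⟨0, sa₂⟩, ⟨4, ha₃⟩⟩
  · exact ⟨⟨5, sa₃⟩, ⟨5, ha₄⟩⟩
  · exact ⟨⟨10, sa₄⟩, ⟨1, ta₄⟩⟩
  · exact ⟨⟨7, sb₀⟩, ⟨7, hb₁⟩⟩
  · exact ⟨⟨3, sb₁⟩, ⟨8, hb₂⟩⟩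
  · exact ⟨⟨4, sb₂⟩, ⟨9, hb₃⟩⟩
  · exact ⟨⟨9, sb₃⟩, ⟨10, hb₄⟩⟩
  · exact ⟨⟨11, hf⟩, ⟨6, tb₄⟩⟩
  · exact ⟨⟨8, sf⟩, ⟨11, tf⟩⟩

/-- The points that can be reached from `e` by applying `s` and `t`. -/
inductive Reachable {X : Type*} (s t : X → X) (e : X) : X → Prop
  | base : Reachable s t e e
  | left {x : X} : Reachable s t e x → Reachable s t e (s x)
  | right {x : X} : Reachable s t e x → Reachable s t e (t x)

/-- Two commuting generators that agree on `e` and on `s e` agree on all points that can be reached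
from `e`. -/
theorem Reachable.eq {X : Type*} {r s t : X → X} {e x : X} (hx : Reachable s t e x)
    (hs : ∀ x, s (s (s (s (s x)))) = x) (hrt : ∀ x, r (t x) = t (r x))
    (hst : ∀ x, s (t (s x)) = t (s (t x))) (hsr : ∀ x, s (r (s x)) = r (s (r x)))
    (he : r e = t e) (he' : r (s e) = t (s e)) : r x = t x := by
  -- This is `u s² = s⁻¹ u² s u`, a form of the braid relation, with `s⁻¹ = s⁴`.
  have hinv (u : X → X) (hsu : ∀ x, s (u (s x)) = u (s (u x))) (y : X) :
      u (s (s y)) = s (s (s (s (u (u (s (u y))))))) := by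
    rw [← hsu y, ← hsu (s y), hs]
  -- Since `s` commutes with neither `r` nor `t`, the induction has to carry the agreement at `s x`
  -- as well.
  suffices H : r x = t x ∧ r (s x) = t (s x) from H.1
  induction hx with
  | base => exact ⟨he, he'⟩
  | @left x _ ih =>
    refine ⟨ih.2, ?_⟩
    have h1 : s (r x) = s (t x) := by rw [ih.1]
    have h2 : r (s (r x)) = t (s (t x)) := by rw [← hsr, ← hst, ih.2]
    have h3 : r (r (s (r x))) = t (t (s (t x))) := by
      rw [h2, hrt, ← h1, h2, h1]
    rw [hinv r hsr, hinv t hst, h3]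
  | @right x _ ih =>
    refine ⟨by rw [hrt, ih.1], ?_⟩
    rw [← ih.1, ← hsr, ih.2, ih.1, ← hst, ← ih.2]

/-! ### Equivalence of words -/

/-- Words that are diagrams with prescribed numbers of end points and 5-move equivalent. -/
def WordEquiv (m n : ℕ) (w w' : Word) : Prop :=
  ∃ (h : Runs w m n) (h' : Runs w' m n), FiveMoveEquiv (⟨w, h⟩ : Diagram m n) ⟨w', h'⟩

namespace WordEquiv

variable {k l m n : ℕ} {u v w w' w'' : Word}

theorem refl (h : Runs w m n) : WordEquiv m n w w := ⟨h, h, .refl _⟩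

theorem symm (h : WordEquiv m n w w') : WordEquiv m n w' w := ⟨h.2.1, h.1, .symm _ _ h.2.2⟩

theorem trans (h : WordEquiv m n w w') (h' : WordEquiv m n w' w'') : WordEquiv m n w w'' :=
  ⟨h.1, h'.2.1, .trans _ _ _ h.2.2 h'.2.2⟩

theorem of_fiveMoveEquiv {D D' : Diagram m n} (h : FiveMoveEquiv D D') : WordEquiv m n D.1 D'.1 :=
  ⟨D.2, D'.2, h⟩

theorem move (h : IsotopyMove w w') (hw : Runs w m n) (hw' : Runs w' m n) : WordEquiv m n w w' :=
  ⟨hw, hw', .rel _ _ (Or.inl ⟨[], w, w', [], h, by simp, by simp⟩)⟩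

theorem five (h : FiveMove w w') (hw : Runs w m n) (hw' : Runs w' m n) : WordEquiv m n w w' :=
  ⟨hw, hw', .rel _ _ (Or.inr ⟨[], w, w', [], h, by simp, by simp⟩)⟩

theorem append_left (hu : Runs u k m) (h : WordEquiv m n w w') :
    WordEquiv k n (u ++ w) (u ++ w') := by
  obtain ⟨hw, hw', h⟩ := h
  refine ⟨runs_append hu hw, runs_append hu hw', ?_⟩
  have key (D D' : Diagram m n) (h : FiveMoveEquiv D D') :
      FiveMoveEquiv (⟨u ++ D.1, runs_append hu D.2⟩ : Diagram k n) ⟨u ++ D'.1, runs_append hu D'.2⟩ := by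
    induction h with
    | rel D D' h =>
      refine .rel _ _ (h.imp ?_ ?_) <;>
      · rintro ⟨x, a, b, y, hab, h1, h2⟩
        exact ⟨u ++ x, a, b, y, hab, by simp [h1], by simp [h2]⟩
    | refl D => exact .refl _
    | symm D D' _ ih => exact .symm _ _ ih
    | trans D D' D'' _ _ ih ih' => exact .trans _ _ _ ih ih'
  exact key _ _ h

theorem append_right (hv : Runs v n l) (h : WordEquiv m n w w') :
    WordEquiv m l (w ++ v) (w' ++ v) := by
  obtain ⟨hw, hw', h⟩ := h
  refine ⟨runs_append hw hv, runs_append hw' hv, ?_⟩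
  have key (D D' : Diagram m n) (h : FiveMoveEquiv D D') :
      FiveMoveEquiv (⟨D.1 ++ v, runs_append D.2 hv⟩ : Diagram m l) ⟨D'.1 ++ v, runs_append D'.2 hv⟩ := by
    induction h with
    | rel D D' h =>
      refine .rel _ _ (h.imp ?_ ?_) <;>
      · rintro ⟨x, a, b, y, hab, h1, h2⟩
        exact ⟨x, a, b, y ++ v, hab, by simp [h1], by simp [h2]⟩
    | refl D => exact .refl _
    | symm D D' _ ih => exact .symm _ _ ih
    | trans D D' D'' _ _ ih ih' => exact .trans _ _ _ ih ih'
  exact key _ _ h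

theorem shift_move (s : ℕ) (h : IsotopyMove w w') : IsotopyMove (shiftWord s w) (shiftWord s w') := by
  cases h with
  | far e f i k => simpa [shiftWord, add_assoc] using IsotopyMove.far e f (s + i) k
  | zigzag₁ i => exact .zigzag₁ (s + i)
  | zigzag₂ i => exact .zigzag₂ (s + i)
  | slide₁ i => exact .slide₁ (s + i)
  | slide₂ i => exact .slide₂ (s + i)
  | slide₃ i => exact .slide₃ (s + i)
  | slide₄ i => exact .slide₄ (s + i)
  | kink₁ i => exact .kink₁ (s + i)
  | kink₂ i => exact .kink₂ (s + i)
  | kink₃ i => exact .kink₃ (s + i)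
  | kink₄ i => exact .kink₄ (s + i)
  | cancel₁ i => exact .cancel₁ (s + i)
  | cancel₂ i => exact .cancel₂ (s + i)
  | braid i => exact .braid (s + i)

theorem shift (s t : ℕ) (h : WordEquiv m n w w') :
    WordEquiv (s + m + t) (s + n + t) (shiftWord s w) (shiftWord s w') := by
  obtain ⟨hw, hw', h⟩ := h
  refine ⟨runs_shift s t hw, runs_shift s t hw', ?_⟩
  have key (D D' : Diagram m n) (h : FiveMoveEquiv D D') :
      FiveMoveEquiv (⟨shiftWord s D.1, runs_shift s t D.2⟩ : Diagram (s + m + t) (s + n + t))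
        ⟨shiftWord s D'.1, runs_shift s t D'.2⟩ := by
    induction h with
    | rel D D' h =>
      refine .rel _ _ (h.imp ?_ ?_)
      · rintro ⟨x, a, b, y, hab, h1, h2⟩
        exact ⟨shiftWord s x, _, _, shiftWord s y, shift_move s hab, by simp [h1, shiftWord],
          by simp [h2, shiftWord]⟩
      · rintro ⟨x, a, b, y, hab, h1, h2⟩
        refine ⟨shiftWord s x, shiftWord s a, shiftWord s b, shiftWord s y, ?_,
          by simp [h1, shiftWord], by simp [h2, shiftWord]⟩
        cases hab with
        | plus i => exact .plus (s + i)
        | minus i => exact .minus (s + i)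
    | refl D => exact .refl _
    | symm D D' _ ih => exact .symm _ _ ih
    | trans D D' D'' _ _ ih ih' => exact .trans _ _ _ ih ih'
  exact key _ _ h

/-- An event may be interchanged with a diagram that lies below it. -/
theorem far_word (e : Piece) (i k c : ℕ) {a b : ℕ} (h : Runs w a b) :
    WordEquiv (i + e.ins + k + a + c) (i + e.outs + k + b + c)
      ((e, i) :: shiftWord (i + e.outs + k) w) (shiftWord (i + e.ins + k) w ++ [(e, i)]) := by
  have he (a : ℕ) : Runs [(e, i)] (i + e.ins + k + a + c) (i + e.outs + k + a + c) :=
    ⟨by omega, by show _ = _; omega⟩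
  induction w generalizing a with
  | nil =>
    cases h
    exact refl (he _)
  | cons x w ih =>
    obtain ⟨f, y⟩ := x
    obtain ⟨h1, h2⟩ := h
    have h1 : y + f.ins ≤ a := h1
    have h3 := ih h2
    have hf : Runs [(f, i + e.ins + (k + y))] (i + e.ins + k + a + c)
        (i + e.ins + k + (a - f.ins + f.outs) + c) :=
      ⟨by omega, by show _ = _; omega⟩
    have hf' : Runs [(f, i + e.outs + (k + y))] (i + e.outs + k + a + c)
        (i + e.outs + k + (a - f.ins + f.outs) + c) :=
      ⟨by omega, by show _ = _; omega⟩
    have h4 := append_right (runs_shift (i + e.outs + k) c h2)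
      (move (.far e f i (k + y)) (runs_append (he a) hf') (runs_append hf (he _)))
    have h5 := append_left hf h3
    have h6 := h4.trans h5
    simpa [shiftWord, add_assoc] using h6

end WordEquiv

open Piece

/-! ### Tangles with four end points on the right -/

/-- 5-move equivalence as a setoid. -/
instance fiveMoveSetoid (m n : ℕ) : Setoid (Diagram m n) where
  r := FiveMoveEquiv
  iseqv := ⟨fun _ => .refl _, fun h => .symm _ _ h, fun h h' => .trans _ _ _ h h'⟩

/-- 5-move equivalence classes of tangles with four end points on the right. -/
abbrev BentClass : Type := Quotient (fiveMoveSetoid 0 4)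

/-- The class of a word. -/
def bentClass (w : Word) (h : Runs w 0 4) : BentClass := ⟦⟨w, h⟩⟧

theorem bentClass_eq_iff {w w' : Word} (h : Runs w 0 4) (h' : Runs w' 0 4) :
    bentClass w h = bentClass w' h' ↔ WordEquiv 0 4 w w' :=
  ⟨fun H => ⟨h, h', Quotient.exact H⟩, fun H => Quotient.sound H.2.2⟩

theorem runs_pos (i : ℕ) (hi : i < 3) : Runs [(pos, i)] 4 4 := ⟨by simp only [ins]; omega, rfl⟩

theorem runs_neg (i : ℕ) (hi : i < 3) : Runs [(neg, i)] 4 4 := ⟨by simp only [ins]; omega, rfl⟩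

/-- Append a diagram on the right. -/
def appendClass (v : Word) (hv : Runs v 4 4) : BentClass → BentClass :=
  Quotient.map (fun D => ⟨D.1 ++ v, runs_append D.2 hv⟩) fun _ _ h =>
    (WordEquiv.of_fiveMoveEquiv h |>.append_right hv).2.2

theorem BentClass.ind {p : BentClass → Prop} (h : ∀ w hw, p (bentClass w hw)) (x : BentClass) : p x :=
  Quotient.ind (fun D => h D.1 D.2) x

theorem appendClass_congr {v v' : Word} (h : WordEquiv 4 4 v v') (x : BentClass) :
    appendClass v h.1 x = appendClass v' h.2.1 x := by
  induction x using BentClass.ind with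
  | h w hw => exact (bentClass_eq_iff _ _).2 (h.append_left hw)

theorem appendClass_appendClass {v v' : Word} (hv : Runs v 4 4) (hv' : Runs v' 4 4) (x : BentClass) :
    appendClass v' hv' (appendClass v hv x) = appendClass (v ++ v') (runs_append hv hv') x := by
  induction x using BentClass.ind with
  | h w hw => exact (bentClass_eq_iff _ _).2 (by
      rw [List.append_assoc]; exact .refl (runs_append hw (runs_append hv hv')))

theorem appendClass_nil (x : BentClass) : appendClass [] rfl x = x := by
  induction x using BentClass.ind with
  | h w hw => exact (bentClass_eq_iff _ _).2 (by rw [List.append_nil]; exact .refl hw)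

/-- The half-twist of the strands `i` and `i + 1`. -/
def twist (i : Fin 3) : BentClass → BentClass := appendClass [(pos, i)] (runs_pos i i.2)

/-- The opposite half-twist of the strands `i` and `i + 1`. -/
def untwist (i : Fin 3) : BentClass → BentClass := appendClass [(neg, i)] (runs_neg i i.2)

theorem twist_untwist (i : Fin 3) (x : BentClass) : twist i (untwist i x) = x := by
  rw [twist, untwist, appendClass_appendClass]
  refine (appendClass_congr ?_ x).trans (appendClass_nil x)
  exact .move (.cancel₂ i) (runs_append (runs_neg i i.2) (runs_pos i i.2)) rfl

theorem twist_five (i : Fin 3) (x : BentClass) :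
    twist i (twist i (twist i (twist i (twist i x)))) = x := by
  have h : Runs (List.replicate 5 (pos, (i : ℕ))) 4 4 :=
    have h := (runs_pos i i.2).1
    ⟨h, h, h, h, h, rfl⟩
  simp only [twist, appendClass_appendClass]
  exact (appendClass_congr (.symm (.five (.plus i) rfl h)) x).trans (appendClass_nil x)

theorem untwist_eq (i : Fin 3) (x : BentClass) :
    untwist i x = twist i (twist i (twist i (twist i x))) := by
  conv_lhs => rw [← twist_five i (untwist i x), twist_untwist]

theorem twist_braid₀ (x : BentClass) :
    twist 1 (twist 0 (twist 1 x)) = twist 0 (twist 1 (twist 0 x)) := by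
  simp only [twist, appendClass_appendClass]
  exact appendClass_congr (.symm (.move (.braid 0) (by simp [Runs, ins, outs])
    (by simp [Runs, ins, outs]))) x

theorem twist_braid₁ (x : BentClass) :
    twist 1 (twist 2 (twist 1 x)) = twist 2 (twist 1 (twist 2 x)) := by
  simp only [twist, appendClass_appendClass]
  exact appendClass_congr (.move (.braid 1) (by simp [Runs, ins, outs])
    (by simp [Runs, ins, outs])) x

theorem twist_comm (x : BentClass) : twist 0 (twist 2 x) = twist 2 (twist 0 x) := by
  simp only [twist, appendClass_appendClass]
  exact appendClass_congr (.symm (.move (.far pos pos 0 0) (by simp [Runs, ins, outs])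
    (by simp [Runs, ins, outs]))) x

/-- The tangle in which strand `0` is joined to strand `1`, and strand `2` to strand `3`. -/
def pairs : BentClass := bentClass [(birth, 0), (birth, 2)] (by simp [Runs, ins, outs])

/-- The tangle in which strand `0` is joined to strand `3`, and strand `1` to strand `2`. -/
def nested : BentClass := bentClass [(birth, 0), (birth, 1)] (by simp [Runs, ins, outs])

theorem WordEquiv.step {m n : ℕ} (u v : Word) {a b : Word} (hab : IsotopyMove a b)
    (h : Runs (u ++ a ++ v) m n) (h' : Runs (u ++ b ++ v) m n) :
    WordEquiv m n (u ++ a ++ v) (u ++ b ++ v) :=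
  ⟨h, h', .rel _ _ (Or.inl ⟨u, a, b, v, hab, rfl, rfl⟩)⟩

theorem pairs_equiv : WordEquiv 0 4 [(birth, 0), (birth, 2)] [(birth, 0), (birth, 0)] :=
  .move (.far birth birth 0 0) (by simp [Runs, ins, outs]) (by simp [Runs, ins, outs])

theorem twist_two_pairs : twist 2 pairs = pairs :=
  (bentClass_eq_iff _ _).2 (.step [(birth, 0)] [] (.kink₁ 2) (by simp [Runs, ins, outs])
    (by simp [Runs, ins, outs]))

theorem twist_zero_pairs : twist 0 pairs = pairs := by
  have h := pairs_equiv.append_right (runs_pos 0 (by decide))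
  refine (bentClass_eq_iff _ _).2 (h.trans (.trans ?_ pairs_equiv.symm))
  exact .step [(birth, 0)] [] (.kink₁ 0) (by simp [Runs, ins, outs]) (by simp [Runs, ins, outs])

/-- Sliding the turning point across a strand replaces the first crossing by one of opposite sign in
the position of the second, and the two cancel. -/
theorem twist_two_twist_one_pairs : twist 2 (twist 1 pairs) = nested :=
  (bentClass_eq_iff _ _).2 ((WordEquiv.symm (.step [(birth, 0)] [(pos, 2)] (.slide₂ 1)
    (by simp [Runs, ins, outs]) (by simp [Runs, ins, outs]))).trans
    (.step [(birth, 0), (birth, 1)] [] (.cancel₂ 2) (by simp [Runs, ins, outs])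
      (by simp [Runs, ins, outs])))

theorem twist_zero_twist_one_pairs : twist 0 (twist 1 pairs) = nested := by
  have h := pairs_equiv.append_right (v := [(pos, 1), (pos, 0)]) (l := 4) (by simp [Runs, ins, outs])
  refine (bentClass_eq_iff _ _).2 (h.trans (.trans (.step [(birth, 0)] [(pos, 0)] (.slide₁ 0)
    (by simp [Runs, ins, outs]) (by simp [Runs, ins, outs])) ?_))
  exact .step [(birth, 0), (birth, 1)] [] (.cancel₂ 0) (by simp [Runs, ins, outs])
      (by simp [Runs, ins, outs])

/-- Together with `twist_two_twist_one_pairs` this supplies the relation `s (t (t (s e))) = e` of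
the orbit count. -/
theorem twist_one_twist_two_nested : twist 1 (twist 2 nested) = pairs :=
  (bentClass_eq_iff _ _).2 ((WordEquiv.step [(birth, 0)] [(pos, 1)] (.slide₁ 1)
    (by simp [Runs, ins, outs]) (by simp [Runs, ins, outs])).trans
    (.step [(birth, 0), (birth, 2)] [] (.cancel₂ 1) (by simp [Runs, ins, outs])
      (by simp [Runs, ins, outs])))

/-- The classes obtained from `pairs` by twisting. -/
abbrev TwistOrbit : BentClass → Prop := Reachable (twist 1) (twist 2) pairs

/-- A half-twist of the left ends of a rational tangle can be carried over to the right ends. The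
general fact `Reachable.eq` needs this only for `pairs` and `twist 1 pairs`. -/
theorem TwistOrbit.twist_zero {x : BentClass} (hx : TwistOrbit x) : twist 0 x = twist 2 x :=
  hx.eq (twist_five 1) twist_comm twist_braid₁ twist_braid₀
    (twist_zero_pairs.trans twist_two_pairs.symm)
    (twist_zero_twist_one_pairs.trans twist_two_twist_one_pairs.symm)

/-- A cyclic rotation of the four end points. -/
def rotate : BentClass → BentClass :=
  Quotient.map (fun D => ⟨[(birth, 0)] ++ shiftWord 1 D.1 ++ [(death, 0)],
    runs_append (runs_append (n := 2) (by simp [Runs, ins, outs]) (runs_shift 1 1 D.2))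
      (by simp [Runs, ins, outs])⟩) fun _ _ h =>
    (((WordEquiv.of_fiveMoveEquiv h).shift 1 1).append_left (u := [(birth, 0)]) (k := 0)
      (by simp [Runs, ins, outs]) |>.append_right (v := [(death, 0)]) (l := 4)
        (by simp [Runs, ins, outs])).2.2

theorem rotate_twist (i : ℕ) (hi : i < 2) (x : BentClass) :
    rotate (twist ⟨i + 1, by omega⟩ x) = twist ⟨i, by omega⟩ (rotate x) := by
  induction x using BentClass.ind with
  | h w hw =>
    refine (bentClass_eq_iff _ _).2 ?_
    have h : WordEquiv 6 4 [(pos, i + 2), (death, 0)] [(death, 0), (pos, i)] := by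
      have := IsotopyMove.far death pos 0 i
      simp only [ins, outs, zero_add, add_comm 2 i] at this
      refine .symm (.move this ?_ ?_)
      · exact ⟨by simp [ins], by simp [ins, outs]; omega, rfl⟩
      · exact ⟨by simp [ins]; omega, by simp [ins, outs], rfl⟩
    have h' := h.append_left (u := [(birth, 0)] ++ shiftWord 1 w) (k := 0)
      (runs_append (n := 2) (by simp [Runs, ins, outs]) (runs_shift 1 1 hw))
    simpa [shiftWord, add_comm 1, add_assoc] using h'

theorem rotate_pairs : rotate pairs = nested :=
  (bentClass_eq_iff _ _).2 ((WordEquiv.symm (.step [(birth, 0), (birth, 1)] [] (.far death birth 0 1)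
    (by simp [Runs, ins, outs]) (by simp [Runs, ins, outs]))).trans
    (.step [(birth, 0)] [(birth, 1)] (.zigzag₂ 0) (by simp [Runs, ins, outs])
      (by simp [Runs, ins, outs])))

/-- Rotation lowers the index of a twist by one. This turns `twist 1` into `twist 0`, which is not
among the generators but acts on the orbit as `twist 2`. -/
theorem TwistOrbit.rotate {x : BentClass} (hx : TwistOrbit x) : TwistOrbit (rotate x) := by
  induction hx with
  | base =>
    rw [rotate_pairs, ← twist_two_twist_one_pairs]
    exact .right (.left .base)
  | @left x _ ih =>
    have := rotate_twist 0 (by decide) x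
    rw [show twist 1 x = twist ⟨0 + 1, by decide⟩ x from rfl, this]
    rw [show twist ⟨0, by decide⟩ (FiveMoves.rotate x) = twist 0 (FiveMoves.rotate x) from rfl,
      ih.twist_zero]
    exact .right ih
  | @right x _ ih =>
    have := rotate_twist 1 (by decide) x
    rw [show twist 2 x = twist ⟨1 + 1, by decide⟩ x from rfl, this]
    exact .left ih

/-! ### Bending a tangle -/

theorem runs_bend {w : Word} (h : Runs w 2 2) : Runs ([(birth, 0), (birth, 1)] ++ shiftWord 2 w) 0 4 :=
  runs_append (n := 4) (by simp [Runs, ins, outs]) (runs_shift 2 0 h)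

/-- Bend the left end points of a tangle to the right. -/
def bend (w : Word) (h : Runs w 2 2) : BentClass :=
  bentClass ([(birth, 0), (birth, 1)] ++ shiftWord 2 w) (runs_bend h)

theorem bend_append {w w' : Word} (h : Runs w 2 2) (h' : Runs w' 2 2) :
    bend (w ++ w') (runs_append h h') =
      appendClass (shiftWord 2 w') (runs_shift 2 0 h') (bend w h) := by
  refine (bentClass_eq_iff _ _).2 ?_
  have := WordEquiv.refl (runs_bend (runs_append h h'))
  simpa [shiftWord] using this

theorem shiftWord_shiftWord (s t : ℕ) (w : Word) :
    shiftWord s (shiftWord t w) = shiftWord (s + t) w := by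
  simp [shiftWord, Function.comp_def, add_assoc]

theorem shiftWord_zero (w : Word) : shiftWord 0 w = w := by simp [shiftWord]

theorem shiftWord_append (s : ℕ) (w w' : Word) :
    shiftWord s (w ++ w') = shiftWord s w ++ shiftWord s w' := by simp [shiftWord]

/-- Rotating a tangle by a quarter turn rotates the bent tangle. -/
theorem bend_rotate {w : Word} (h : Runs w 2 2)
    (h' : Runs ((birth, 2) :: (shiftWord 1 w ++ [(death, 0)])) 2 2) :
    bend ((birth, 2) :: (shiftWord 1 w ++ [(death, 0)])) h' = rotate (bend w h) := by
  -- Both diagrams straighten to the one in which `w` occupies the two middle strands and its left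
  -- ends are bent outwards, one upwards and one downwards.
  refine (bentClass_eq_iff _ _).2 (WordEquiv.trans
    (w' := [(birth, 0), (birth, 0)] ++ shiftWord 1 w) ?_ (WordEquiv.symm ?_))
  · have e : [(birth, 0), (birth, 1)] ++ shiftWord 2 ((birth, 2) :: (shiftWord 1 w ++ [(death, 0)])) =
        [(birth, 0), (birth, 1), (birth, 4)] ++ (shiftWord 3 w ++ [(death, 2)]) := by
      show [_, _] ++ ((_, _) :: shiftWord 2 (_ ++ _)) = _
      rw [shiftWord_append, shiftWord_shiftWord]
      rfl
    rw [e]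
    have h1 : WordEquiv 0 4 ([(birth, 0), (birth, 1), (birth, 4)] ++ (shiftWord 3 w ++ [(death, 2)]))
        ([(birth, 0), (birth, 2), (birth, 1)] ++ (shiftWord 3 w ++ [(death, 2)])) :=
      (WordEquiv.step [(birth, 0)] [] (.far birth birth 1 1) (m := 0) (n := 6)
        (by simp [Runs, ins, outs]) (by simp [Runs, ins, outs])).append_right
        (runs_append (runs_shift 3 1 h) (by simp [Runs, ins, outs]))
    have h2 : WordEquiv 0 4 ([(birth, 0), (birth, 2)] ++ ((birth, 1) :: shiftWord 3 w) ++ [(death, 2)])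
        ([(birth, 0), (birth, 2)] ++ (shiftWord 1 w ++ [(birth, 1)]) ++ [(death, 2)]) :=
      ((WordEquiv.far_word birth 1 0 1 h).append_left (u := [(birth, 0), (birth, 2)]) (k := 0)
        (by simp [Runs, ins, outs])).append_right (by simp [Runs, ins, outs])
    have h3 : WordEquiv 0 4 (([(birth, 0), (birth, 2)] ++ shiftWord 1 w) ++ [(birth, 1), (death, 2)])
        (([(birth, 0), (birth, 2)] ++ shiftWord 1 w) ++ []) :=
      (WordEquiv.move (.zigzag₁ 1) (m := 4) (n := 4) (by simp [Runs, ins, outs])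
        (by simp [Runs])).append_left
        (runs_append (n := 4) (by simp [Runs, ins, outs]) (runs_shift 1 1 h))
    have h4 := pairs_equiv.append_right (runs_shift 1 1 h)
    simp only [List.append_assoc, List.cons_append, List.nil_append, List.append_nil] at h1 h2 h3 h4 ⊢
    exact h1.trans (h2.trans (h3.trans h4))
  · have e : [(birth, 0)] ++ shiftWord 1 ([(birth, 0), (birth, 1)] ++ shiftWord 2 w) ++ [(death, 0)] =
        [(birth, 0), (birth, 1), (birth, 2)] ++ (shiftWord 3 w ++ [(death, 0)]) := by
      rw [shiftWord_append, shiftWord_shiftWord]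
      simp [shiftWord]
    show WordEquiv 0 4 ([(birth, 0)] ++ shiftWord 1 ([(birth, 0), (birth, 1)] ++ shiftWord 2 w) ++ [(death, 0)]) _
    rw [e]
    have h1 : WordEquiv 0 4 ([(birth, 0), (birth, 1), (birth, 2)] ++ (shiftWord 3 w ++ [(death, 0)]))
        ([(birth, 0), (birth, 1), (birth, 2)] ++ ((death, 0) :: shiftWord 1 w)) :=
      ((WordEquiv.far_word death 0 1 1 h).symm).append_left (by simp [Runs, ins, outs])
    have h2 : WordEquiv 0 4 ([(birth, 0), (birth, 1), (birth, 2), (death, 0)] ++ shiftWord 1 w)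
        ([(birth, 0), (birth, 1), (death, 0), (birth, 0)] ++ shiftWord 1 w) :=
      (WordEquiv.symm (.step [(birth, 0), (birth, 1)] [] (.far death birth 0 0) (m := 0) (n := 4)
        (by simp [Runs, ins, outs]) (by simp [Runs, ins, outs]))).append_right (runs_shift 1 1 h)
    have h3 : WordEquiv 0 4 ([(birth, 0), (birth, 1), (death, 0), (birth, 0)] ++ shiftWord 1 w)
        ([(birth, 0), (birth, 0)] ++ shiftWord 1 w) :=
      (WordEquiv.step [(birth, 0)] [(birth, 0)] (.zigzag₂ 0) (m := 0) (n := 4)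
        (by simp [Runs, ins, outs]) (by simp [Runs, ins, outs])).append_right (runs_shift 1 1 h)
    exact h1.trans (h2.trans h3)

/-- Nested caps bring the bent ends back to the left: once `w` has been moved past the caps, two
zigzags straighten. Hence bending loses no information about 5-move classes. -/
theorem unbend_equiv {w : Word} (h : Runs w 2 2) :
    WordEquiv 2 2 (shiftWord 2 ([(birth, 0), (birth, 1)] ++ shiftWord 2 w) ++ [(death, 1), (death, 0)])
      w := by
  rw [shiftWord_append, shiftWord_shiftWord]
  have h1 : WordEquiv 2 2 ([(birth, 2), (birth, 3)] ++ (shiftWord 4 w ++ [(death, 1)]) ++ [(death, 0)])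
      ([(birth, 2), (birth, 3)] ++ ((death, 1) :: shiftWord 2 w) ++ [(death, 0)]) :=
    (((WordEquiv.far_word death 1 1 0 h).symm).append_left (u := [(birth, 2), (birth, 3)]) (k := 2)
      (by simp [Runs, ins, outs])).append_right (by simp [Runs, ins, outs])
  have h2 : WordEquiv 2 2 ([(birth, 2), (birth, 3), (death, 1)] ++ (shiftWord 2 w ++ [(death, 0)]))
      ([(birth, 2), (birth, 3), (death, 1)] ++ ((death, 0) :: shiftWord 0 w)) :=
    ((WordEquiv.far_word death 0 0 0 h).symm).append_left (by simp [Runs, ins, outs])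
  have h3 : WordEquiv 2 2 ([(birth, 2), (birth, 3), (death, 1), (death, 0)] ++ w)
      ([(birth, 2), (death, 1), (birth, 1), (death, 0)] ++ w) :=
    (WordEquiv.symm (.step [(birth, 2)] [(death, 0)] (.far death birth 1 0) (m := 2) (n := 2)
      (by simp [Runs, ins, outs]) (by simp [Runs, ins, outs]))).append_right h
  have h4 : WordEquiv 2 2 ([(birth, 2), (death, 1), (birth, 1), (death, 0)] ++ w)
      ([(birth, 1), (death, 0)] ++ w) :=
    (WordEquiv.step [] [(birth, 1), (death, 0)] (.zigzag₂ 1) (m := 2) (n := 2)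
      (by simp [Runs, ins, outs]) (by simp [Runs, ins, outs])).append_right h
  have h5 : WordEquiv 2 2 ([(birth, 1), (death, 0)] ++ w) w :=
    (WordEquiv.move (.zigzag₂ 0) (m := 2) (n := 2)
      (by simp [Runs, ins, outs]) (by simp [Runs])).append_right h
  rw [shiftWord_zero] at h2
  simp only [List.append_assoc, List.cons_append, List.nil_append] at h1 h2 h3 h4 h5
  have := h1.trans (h2.trans (h3.trans (h4.trans h5)))
  simpa [shiftWord] using this

theorem fiveMoveEquiv_of_bend_eq {T T' : TwoTangle} (h : bend T.1 T.2 = bend T'.1 T'.2) :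
    FiveMoveEquiv T T' := by
  have h1 := (((bentClass_eq_iff _ _).1 h).shift 2 0).append_right (v := [(death, 1), (death, 0)])
    (l := 2) (by simp [Runs, ins, outs])
  exact ((unbend_equiv T.2).symm.trans (h1.trans (unbend_equiv T'.2))).2.2

/-! ### Rational tangles are obtained by twisting -/

theorem TwistOrbit.append_replicate {x : BentClass} (hx : TwistOrbit x) (e : Piece)
    (he : e = pos ∨ e = neg) (k : ℕ) (h : Runs (List.replicate k (e, 2)) 4 4) :
    TwistOrbit (appendClass (List.replicate k (e, 2)) h x) := by
  induction k generalizing x with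
  | zero =>
    have := appendClass_nil x
    exact this.symm ▸ hx
  | succ k ih =>
    have hk : Runs (List.replicate k (e, 2)) 4 4 := by
      rcases he with rfl | rfl <;> exact h.2
    have h1 : Runs [(e, 2)] 4 4 := by
      rcases he with rfl | rfl
      exacts [runs_pos 2 (by decide), runs_neg 2 (by decide)]
    have h2 : TwistOrbit (appendClass [(e, 2)] h1 x) := by
      rcases he with rfl | rfl
      · exact .right hx
      · show TwistOrbit (untwist 2 x)
        -- By a 5-move, one negative half-twist equals four positive ones, so the orbit under
        -- positive twists suffices.
        rw [untwist_eq]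
        exact .right (.right (.right (.right hx)))
    have := ih h2 hk
    rwa [appendClass_appendClass] at this

theorem mirrorWord_mirrorWord (w : Word) : mirrorWord (mirrorWord w) = w := by
  have : ∀ x : Piece × ℕ, (x.1.mirror.mirror, x.2) = x := by
    rintro ⟨_ | _ | _ | _, i⟩ <;> rfl
  simp only [mirrorWord, List.map_map]
  exact (List.map_congr_left fun x _ => this x).trans (List.map_id w)

/-- Inversion is a quarter turn of the mirror image, so each half of the statement for `a :: l` uses
the other half for `l`. -/
theorem twistOrbit_bend_conway (l : List ℤ) : TwistOrbit (bend (conway l).1 (conway l).2) ∧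
    TwistOrbit (bend (mirrorWord (conway l).1) (runs_mirror (conway l).2)) := by
  induction l with
  | nil =>
    have h : bend [(death, 0), (birth, 0)] infinityTangle.2 = pairs :=
      (bentClass_eq_iff _ _).2 (.step [(birth, 0)] [(birth, 2)] (.zigzag₁ 1)
        (by simp [Runs, ins, outs]) (by simp [Runs, ins, outs]))
    exact ⟨h ▸ .base, h ▸ .base⟩
  | cons a l ih =>
    obtain ⟨ih, ih'⟩ := ih
    have key (e : Piece) (he : e = pos ∨ e = neg) (k : ℕ) (h : Runs (List.replicate k (e, 0)) 2 2)
        {w : Word} (hw : Runs w 2 2) (ho : TwistOrbit (bend w hw)) :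
        TwistOrbit (bend (w ++ List.replicate k (e, 0)) (runs_append hw h)) := by
      have h1 := runs_shift 2 0 h
      rw [bend_append hw h]
      simp only [shiftWord, List.map_replicate] at h1 ⊢
      exact ho.append_replicate e he k h1
    have hinv := bend_rotate (runs_mirror (conway l).2) (inversion (conway l)).2
    have hinv' : Runs ((birth, 2) :: (shiftWord 1 (conway l).1 ++ [(death, 0)])) 2 2 :=
      ⟨by simp [ins], runs_append (runs_shift 1 1 (conway l).2) (by simp [Runs, ins, outs])⟩
    have e : mirrorWord (inversion (conway l)).1 =
        (birth, 2) :: (shiftWord 1 (conway l).1 ++ [(death, 0)]) := by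
      conv_rhs => rw [← mirrorWord_mirrorWord (conway l).1]
      simp [inversion, mirrorWord, shiftWord, Function.comp_def, mirror]
    constructor
    · have h1 : TwistOrbit (bend (inversion (conway l)).1 (inversion (conway l)).2) :=
        hinv ▸ ih'.rotate
      exact key _ (by split_ifs <;> simp) _ (integerTangle a).2 _ h1
    · have h1 : TwistOrbit (bend _ hinv') := bend_rotate (conway l).2 hinv' ▸ ih.rotate
      have h2 : mirrorWord (integerTangle a).1 =
          List.replicate a.natAbs ((if 0 ≤ a then pos else neg : Piece).mirror, 0) := by
        simp [mirrorWord, integerTangle]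
      have h3 := key (if 0 ≤ a then pos else neg : Piece).mirror
        (by split_ifs <;> simp [mirror]) a.natAbs (h2 ▸ runs_mirror (integerTangle a).2) hinv' h1
      have h4 : mirrorWord (conway (a :: l)).1 = (birth, 2) :: (shiftWord 1 (conway l).1 ++
          [(death, 0)]) ++ List.replicate a.natAbs ((if 0 ≤ a then pos else neg : Piece).mirror, 0) := by
        rw [← e, ← h2]
        simp [conway, add, mirrorWord]
      simp only [h4]
      exact h3

/-! ### The classification -/

/-- Continued fractions of the twelve fractions. -/
def twelveExpansions : Fin 12 → List ℤ :=
  ![[], [0], [-1], [1], [-2], [2], [0, 2, 2], [2, 2], [1, 2], [-1, -2], [0, 2], [0, -2]]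

theorem twelveExpansions_injective {k k' : Fin 12}
    (h : ModEqUpToSign (fraction (twelveExpansions k)).1 (fraction (twelveExpansions k)).2
      (fraction (twelveExpansions k')).1 (fraction (twelveExpansions k')).2) : k = k' := by
  revert k k'
  unfold ModEqUpToSign Int.ModEq
  decide

/-- A counting argument: the twelve standard tangles occupy at most twelve points of the orbit and
are separated by the invariant, so they occupy all of them. No tangle has to be reduced by explicit
moves. -/
theorem exists_twelveExpansions (l : List ℤ) :
    ∃ k, FiveMoveEquiv (conway l) (conway (twelveExpansions k)) := by
  obtain ⟨g, ⟨k₀, hk₀⟩, hg⟩ := exists_twelve_points (twist_five 1) (twist_five 2) twist_braid₁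
    twist_two_pairs (by rw [twist_two_twist_one_pairs, twist_one_twist_two_nested])
  have hr (x : BentClass) (hx : TwistOrbit x) : ∃ k, g k = x := by
    induction hx with
    | base => exact ⟨k₀, hk₀⟩
    | left _ ih =>
      obtain ⟨k, rfl⟩ := ih
      exact (hg k).1
    | right _ ih =>
      obtain ⟨k, rfl⟩ := ih
      exact (hg k).2
  have hb (l : List ℤ) := hr _ (twistOrbit_bend_conway l).1
  -- The index `f l` in `Fin 12` locates the bent tangle of `l`.
  choose f hf using hb
  have hinj : Function.Injective fun k => f (twelveExpansions k) := by
    intro k k' h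
    have h' : f (twelveExpansions k) = f (twelveExpansions k') := h
    exact twelveExpansions_injective (modEqUpToSign_of_fiveMoveEquiv_conway
      (fiveMoveEquiv_of_bend_eq
        ((hf (twelveExpansions k)).symm.trans ((congrArg g h').trans (hf (twelveExpansions k'))))))
  obtain ⟨k, hk⟩ := Finite.surjective_of_injective hinj (f l)
  refine ⟨k, fiveMoveEquiv_of_bend_eq ?_⟩
  rw [← hf l, ← hk, hf]

namespace ModEqUpToSign

variable {p q p' q' p'' q'' : ℤ}

theorem refl (p q : ℤ) : ModEqUpToSign p q p q := Or.inl ⟨rfl, rfl⟩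

theorem neg (p q : ℤ) : ModEqUpToSign p q (-p) (-q) := Or.inr (by simp)

theorem symm (h : ModEqUpToSign p q p' q') : ModEqUpToSign p' q' p q := by
  rw [modEqUpToSign_iff] at *
  rcases h with ⟨h, h'⟩ | ⟨h, h'⟩ <;> simp [h, h']

theorem trans (h : ModEqUpToSign p q p' q') (h' : ModEqUpToSign p' q' p'' q'') :
    ModEqUpToSign p q p'' q'' := by
  rw [modEqUpToSign_iff] at *
  rcases h with ⟨h1, h2⟩ | ⟨h1, h2⟩ <;> rcases h' with ⟨h3, h4⟩ | ⟨h3, h4⟩ <;> simp [h1, h2, h3, h4]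

end ModEqUpToSign

theorem IsRational.exists_conway {p q : ℤ} {T : TwoTangle} (h : IsRational p q T) :
    ∃ l, ModEqUpToSign p q (fraction l).1 (fraction l).2 ∧ FiveMoveEquiv T (conway l) := by
  obtain ⟨l, hl, hT⟩ := h
  refine ⟨l, ?_, isotopic_imp_fiveMoveEquiv hT⟩
  rcases hl with hl | hl <;> rw [hl]
  · exact .refl p q
  · exact .neg p q

/-- Classification of rational tangles up to 5-moves. -/
theorem IsRational.fiveMoveEquiv_iff {p q p' q' : ℤ} {T T' : TwoTangle} (h : IsRational p q T)
    (h' : IsRational p' q' T') : FiveMoveEquiv T T' ↔ ModEqUpToSign p q p' q' := by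
  obtain ⟨l, hl, hT⟩ := h.exists_conway
  obtain ⟨l', hl', hT'⟩ := h'.exists_conway
  constructor
  · intro H
    exact (hl.trans (modEqUpToSign_of_fiveMoveEquiv_conway
      (((hT.symm.trans _ _ _ H).trans _ _ _ hT')))).trans hl'.symm
  · intro H
    obtain ⟨k, hk⟩ := exists_twelveExpansions l
    obtain ⟨k', hk'⟩ := exists_twelveExpansions l'
    have hkk : k = k' := twelveExpansions_injective
      ((modEqUpToSign_of_fiveMoveEquiv_conway hk).symm.trans
        (hl.symm.trans (H.trans (hl'.trans (modEqUpToSign_of_fiveMoveEquiv_conway hk')))))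
    subst hkk
    exact (hT.trans _ _ _ hk).trans _ _ _ (hT'.trans _ _ _ hk').symm

theorem IsRational.inClass_iff {p q r s : ℤ} {T : TwoTangle} (h : IsRational p q T)
    (hc : IsCoprime r s) : InClass r s T ↔ ModEqUpToSign p q r s := by
  constructor
  · rintro ⟨R, hR, hTR⟩
    exact (h.fiveMoveEquiv_iff hR).1 hTR
  · intro H
    obtain ⟨R, hR⟩ := exists_isRational r s hc
    exact ⟨R, hR, (h.fiveMoveEquiv_iff hR).2 H⟩

theorem existsUnique_modEqUpToSign {p q : ℤ} (h : IsCoprime p q) :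
    ∃! c : ℤ × ℤ, c ∈ twelveFractions ∧ ModEqUpToSign p q c.1 c.2 := by
  have hc : ¬ ((p : ZMod 5) = 0 ∧ (q : ZMod 5) = 0) := by
    rintro ⟨ha, hb⟩
    obtain ⟨x, y, hxy⟩ := h
    have := congrArg (Int.cast : ℤ → ZMod 5) hxy
    push_cast at this
    rw [ha, hb, mul_zero, mul_zero, zero_add] at this
    exact absurd this (by decide)
  have hex : ∀ p q : ZMod 5, ¬ (p = 0 ∧ q = 0) → ∃ c ∈ twelveFractions,
      (q = (c.2 : ZMod 5) ∧ p = (c.1 : ZMod 5)) ∨ (q = -(c.2 : ZMod 5) ∧ p = -(c.1 : ZMod 5)) := by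
    decide
  have hun : ∀ c ∈ twelveFractions, ∀ d ∈ twelveFractions,
      ModEqUpToSign c.1 c.2 d.1 d.2 → c = d := by
    unfold ModEqUpToSign Int.ModEq
    decide
  obtain ⟨c, hc1, hc2⟩ := hex p q hc
  exact ⟨c, ⟨hc1, modEqUpToSign_iff.2 hc2⟩,
    fun d ⟨hd1, hd2⟩ => hun d hd1 c hc1 (hd2.symm.trans (modEqUpToSign_iff.2 hc2))⟩

end FiveMoves

open FiveMoves

theorem proposition2p11 :
    (∀ (p q : ℤ) (T : TwoTangle), IsRational p q T →
      (∃! c : ℤ × ℤ, c ∈ twelveFractions ∧ InClass c.1 c.2 T) ∧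
      (InClass 1 0 T ↔ q ≡ 0 [ZMOD 5] ∧ (p ≡ 1 [ZMOD 5] ∨ p ≡ -1 [ZMOD 5])) ∧
      (InClass 2 5 T ↔ q ≡ 0 [ZMOD 5] ∧ (p ≡ 2 [ZMOD 5] ∨ p ≡ -2 [ZMOD 5])) ∧
      (InClass 0 1 T ↔ (q ≡ 1 [ZMOD 5] ∨ q ≡ -1 [ZMOD 5]) ∧ p ≡ 0 [ZMOD 5]) ∧
      (InClass 5 2 T ↔ (q ≡ 2 [ZMOD 5] ∨ q ≡ -2 [ZMOD 5]) ∧ p ≡ 0 [ZMOD 5]) ∧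
      (InClass (-1) 1 T ↔ (q ≡ 1 [ZMOD 5] ∨ q ≡ -1 [ZMOD 5]) ∧ p ≡ -q [ZMOD 5]) ∧
      (InClass 3 2 T ↔ (q ≡ 2 [ZMOD 5] ∨ q ≡ -2 [ZMOD 5]) ∧ p ≡ -q [ZMOD 5]) ∧
      (InClass 1 1 T ↔ (q ≡ 1 [ZMOD 5] ∨ q ≡ -1 [ZMOD 5]) ∧ p ≡ q [ZMOD 5]) ∧
      (InClass (-3) 2 T ↔ (q ≡ 2 [ZMOD 5] ∨ q ≡ -2 [ZMOD 5]) ∧ p ≡ q [ZMOD 5]) ∧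
      (InClass (-2) 1 T ↔ (q ≡ 1 [ZMOD 5] ∨ q ≡ -1 [ZMOD 5]) ∧ p ≡ -2 * q [ZMOD 5]) ∧
      (InClass 1 2 T ↔ (q ≡ 2 [ZMOD 5] ∨ q ≡ -2 [ZMOD 5]) ∧ p ≡ -2 * q [ZMOD 5]) ∧
      (InClass 2 1 T ↔ (q ≡ 1 [ZMOD 5] ∨ q ≡ -1 [ZMOD 5]) ∧ p ≡ 2 * q [ZMOD 5]) ∧
      (InClass (-1) 2 T ↔ (q ≡ 2 [ZMOD 5] ∨ q ≡ -2 [ZMOD 5]) ∧ p ≡ 2 * q [ZMOD 5])) ∧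
    (∀ (p q p' q' : ℤ) (T T' : TwoTangle), IsRational p q T → IsRational p' q' T' →
      (FiveMoveEquiv T T' ↔
        (q ≡ q' [ZMOD 5] ∧ p ≡ p' [ZMOD 5]) ∨ (q ≡ -q' [ZMOD 5] ∧ p ≡ -p' [ZMOD 5]))) := by
  refine ⟨fun p q T hT => ?_, fun p q p' q' T T' h h' => h.fiveMoveEquiv_iff h'⟩
  have hcop : ∀ c ∈ twelveFractions, IsCoprime c.1 c.2 := by
    simp only [Int.isCoprime_iff_gcd_eq_one]
    decide
  have hcl (r s : ℤ) (hrs : (r, s) ∈ twelveFractions) : InClass r s T ↔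
      ((q : ZMod 5) = s ∧ (p : ZMod 5) = r) ∨ ((q : ZMod 5) = -s ∧ (p : ZMod 5) = -r) :=
    (hT.inClass_iff (hcop _ hrs)).trans modEqUpToSign_iff
  have hm (a b : ℤ) : a ≡ b [ZMOD 5] ↔ (a : ZMod 5) = b :=
    (ZMod.intCast_eq_intCast_iff a b 5).symm
  constructor
  · obtain ⟨c, ⟨hc, hc'⟩, hu⟩ := existsUnique_modEqUpToSign hT.isCoprime
    exact ⟨c, ⟨hc, (hT.inClass_iff (hcop c hc)).2 hc'⟩, fun d ⟨hd, hd'⟩ =>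
      hu d ⟨hd, (hT.inClass_iff (hcop d hd)).1 hd'⟩⟩
  rw [hcl 1 0 (by decide), hcl 2 5 (by decide), hcl 0 1 (by decide), hcl 5 2 (by decide),
    hcl (-1) 1 (by decide), hcl 3 2 (by decide), hcl 1 1 (by decide), hcl (-3) 2 (by decide),
    hcl (-2) 1 (by decide), hcl 1 2 (by decide), hcl 2 1 (by decide), hcl (-1) 2 (by decide)]
  simp only [hm]
  push_cast
  -- Only residues are left, so each criterion becomes a finite check.
  generalize (p : ZMod 5) = p
  generalize (q : ZMod 5) = q
  refine ⟨?_, ?_, ?_, ?_, ?_, ?_, ?_, ?_, ?_, ?_, ?_, ?_⟩ <;> revert p q <;> decide
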